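/- Fix $\alpha\in(0,\tfrac13)$. Let $p_1=(0,0)$, $p_2=(\tfrac12,\tfrac{\sqrt3}{2})$, $p_3=(1,0)$ be the vertices of the unit equilateral triangle $T$, and let $p_4=\tfrac{p_2+p_3}2$, $p_5=\tfrac{p_1+p_3}2$, $p_6=\tfrac{p_1+p_2}2$. Put $F_j(x)=A_j(x-p_j)+p_j$, where $A_1=A_2=A_3=\tfrac{1-\alpha}2 I$ and, for $i=1,2,3$, $A_{i+3}$ is $\alpha$ times the orthogonal projection onto the direction of the side of $T$ that contains $p_{i+3}$. The *stretched Sierpinski gasket* $K_\alpha$ is the unique non-empty compact set $K\subset\mathbb R^2$ with $K=\bigcup_{j=1}^6F_j(K)$. Its *geodesic distance* $d_{geo}(x,y)$ is the infimum of the lengths of the continuous paths in $K_\alpha$ from $x$ to $y$, and for $f:K_\alpha\to\mathbb C$ $$\mathrm{Lip}_g(f)=\sup\Big\{\tfrac{|f(x)-f(y)|}{d_{geo}(x,y)}: x,y\in K_\alpha,\ x\ne y\Big\}\in[0,\infty].$$ Let $\mathscr E$ be the countable collection of the following closed line segments, for all $n\ge 0$ and all words $w\in\{1,2,3\}^n$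 (with $F_w=F_{w_n}\circ\dots\circ F_{w_1}$): the three sides of the triangle with vertices $F_w(p_1),F_w(p_2),F_w(p_3)$, and the three joining segments $F_w(F_{i+3}(T))$, $i=1,2,3$. All of them lie in $K_\alpha$. For $\epsilon\in\mathscr E$ of length $\ell_\epsilon$ let $R_\epsilon:[0,\ell_\epsilon]\to K_\alpha$ be its parametrization by arclength. For $\ell>0$ let $\mathcal H_\ell=L^2([-\ell,\ell],(2\ell)^{-1}dx)$, with the orthonormal basis $\phi^\ell_k(x)=e^{i\pi kx/\ell}$, $k\in\mathbb Z$. Let $D$ be the closure of $-i\frac{d}{dx}$ on $\mathrm{span}\{\phi^\ell_k\}$, that is, the self-adjoint operator with $D\phi_k^\ell=\frac{\pi k}{\ell}\phi_k^\ell$ on its maximal domain, and let $D_\ell=D+\frac{\pi}{2\ell}I$. Define $$\mathcal H_\alpha=\bigoplus_{\epsilon\in\mathscr E}\mathcal H_{\ell_\epsilon},\qquad D_\alpha=\bigoplus_{\epsilon\in\mathscr E}D_{\ell_\epsilon},\qquad \pi_\alpha(f)\,(h_\epsilon)_{\epsilon}=\big(f(R_\epsilon(|\cdot|))\,h_\epsilon\big)_{\epsilon}\quad(f\in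 C(K_\alpha)),$$ where $C(K_\alpha)$ is the space of continuous functions $K_\alpha\to\mathbb C$ and $D_\alpha$ has its maximal domain $\{(h_\epsilon): h_\epsilon\in\mathrm{Dom}(D_{\ell_\epsilon}),\ \sum_\epsilon\|D_{\ell_\epsilon}h_\epsilon\|^2<\infty\}$. We say that $[D_\alpha,\pi_\alpha(f)]$ is *bounded* if the set $\{h\in\mathrm{Dom}(D_\alpha):\pi_\alpha(f)h\in\mathrm{Dom}(D_\alpha)\}$ is a core for $D_\alpha$ (for instance, if $\pi_\alpha(f)$ maps $\mathrm{Dom}(D_\alpha)$ into itself) and there is a constant $C$ such that $\|D_\alpha\pi_\alpha(f)h-\pi_\alpha(f)D_\alpha h\|\le C\|h\|$ for all $h$ in this set. **Proposition.** Let $f\in C(K_\alpha)$ be such that $[D_\alpha,\pi_\alpha(f)]$ is bounded. Then $f(R_\epsilon(|\cdot|))\in\mathrm{Dom}(D)\subset\mathcal H_{\ell_\epsilon}$ for every $\epsilon\in\mathscr E$, and, with $$\|D_\alpha f\|_{\infty,K_\alpha}:=\sup_{\epsilon\in\mathscr E}\big\|D\big(f(R_\epsilon(|\cdot|))\big)\big\|_{L^\infty([-\ell_\epsilon,\ell_\epsilon])},$$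 one has $$\|D_\alpha f\|_{\infty,K_\alpha}=\mathrm{Lip}_g(f)<\infty .$$ -/

import Mathlib

open MeasureTheory Set
open scoped ENNReal NNReal

noncomputable section

namespace StretchedGasket

/-! ### The stretched Sierpinski gasket -/

/-- The Euclidean plane. -/
abbrev Plane : Type := EuclideanSpace ℝ (Fin 2)

/-- The range of the parameter of the stretched gasket. -/
abbrev Param : Type := Set.Ioo (0 : ℝ) (1 / 3)

/-- The points `p₁, …, p₆` (indexed here by `0, …, 5`): the vertices of the unit equilateral
triangle, followed by the midpoints of the sides opposite to them. -/
def gasketPoint : Fin 6 → Plane :=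
  ![!₂[0, 0], !₂[1 / 2, √3 / 2], !₂[1, 0],
    midpoint ℝ !₂[1 / 2, √3 / 2] !₂[1, 0],
    midpoint ℝ !₂[0, 0] !₂[1, 0],
    midpoint ℝ !₂[0, 0] !₂[1 / 2, √3 / 2]]

/-- The matrices `A₁, …, A₆`. -/
def gasketMatrix (α : Param) : Fin 6 → Matrix (Fin 2) (Fin 2) ℝ :=
  ![((1 - α.1) / 2) • !![1, 0; 0, 1],
    ((1 - α.1) / 2) • !![1, 0; 0, 1],
    ((1 - α.1) / 2) • !![1, 0; 0, 1],
    (α.1 / 4) • !![1, -√3; -√3, 3],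
    α.1 • !![1, 0; 0, 0],
    (α.1 / 4) • !![1, √3; √3, 3]]

/-- The affine contractions `F_j x = A_j (x - p_j) + p_j`. -/
def gasketMap (α : Param) (j : Fin 6) (x : Plane) : Plane :=
  Matrix.toEuclideanLin (gasketMatrix α j) (x - gasketPoint j) + gasketPoint j

theorem norm_gasketMatrix_le (α : Param) (j : Fin 6) (v : Plane) :
    ‖Matrix.toEuclideanLin (gasketMatrix α j) v‖ ≤ (1 / 2) * ‖v‖ := by
  obtain ⟨a, h0, h1⟩ := α
  have h3 : √3 * √3 = 3 := Real.mul_self_sqrt (by norm_num)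
  have h3' : √3 ^ 2 = 3 := Real.sq_sqrt (by norm_num)
  have ha1 : a ^ 2 ≤ 1 / 4 := by nlinarith
  have ha2 : ((1 - a) / 2) ^ 2 ≤ 1 / 4 := by nlinarith
  rw [EuclideanSpace.norm_eq, EuclideanSpace.norm_eq]
  apply Real.sqrt_le_iff.2
  refine ⟨by positivity, ?_⟩
  rw [mul_pow, Real.sq_sqrt (by positivity)]
  simp only [Fin.sum_univ_two, Real.norm_eq_abs, sq_abs]
  have hx := sq_nonneg (v 0)
  have hy := sq_nonneg (v 1)
  have hp := sq_nonneg (√3 * v 0 + v 1)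
  have hm := sq_nonneg (√3 * v 0 - v 1)
  fin_cases j <;>
    simp [gasketMatrix, Matrix.toLpLin_apply, Matrix.mulVec, dotProduct, Fin.sum_univ_two]
  · nlinarith
  · nlinarith
  · nlinarith
  · have e : (a / 4 * v 0 + -(a / 4 * √3 * v 1)) ^ 2 + (-(a / 4 * √3 * v 0) + a / 4 * 3 * v 1) ^ 2
        = a ^ 2 * (v 0 ^ 2 + v 1 ^ 2 - (√3 * v 0 + v 1) ^ 2 / 4) := by
      ring_nf; rw [h3']; ring
    rw [e]
    nlinarith [mul_le_mul_of_nonneg_right ha1 (add_nonneg hx hy), mul_nonneg (sq_nonneg a) hp]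
  · nlinarith
  · have e : (a / 4 * v 0 + a / 4 * √3 * v 1) ^ 2 + (a / 4 * √3 * v 0 + a / 4 * 3 * v 1) ^ 2
        = a ^ 2 * (v 0 ^ 2 + v 1 ^ 2 - (√3 * v 0 - v 1) ^ 2 / 4) := by
      ring_nf; rw [h3']; ring
    rw [e]
    nlinarith [mul_le_mul_of_nonneg_right ha1 (add_nonneg hx hy), mul_nonneg (sq_nonneg a) hm]

theorem lipschitzWith_gasketMap (α : Param) (j : Fin 6) :
    LipschitzWith (1 / 2) (gasketMap α j) := by
  refine LipschitzWith.of_dist_le_mul fun x y => ?_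
  have : gasketMap α j x - gasketMap α j y
      = Matrix.toEuclideanLin (gasketMatrix α j) (x - y) := by
    simp only [gasketMap, map_sub]; abel
  rw [dist_eq_norm, this, dist_eq_norm]
  simpa using norm_gasketMatrix_le α j (x - y)

theorem existsUnique_gasket (α : Param) :
    ∃! K : TopologicalSpace.NonemptyCompacts Plane,
      (K : Set Plane) = ⋃ j, gasketMap α j '' K := by
  let Φ : TopologicalSpace.NonemptyCompacts Plane → TopologicalSpace.NonemptyCompacts Plane :=
    fun K => ⟨⟨⋃ j, gasketMap α j '' K, isCompact_iUnion fun j =>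
      K.isCompact.image (lipschitzWith_gasketMap α j).continuous⟩,
      nonempty_iUnion.2 ⟨0, K.nonempty.image _⟩⟩
  have hΦ : ContractingWith (1 / 2) Φ := by
    refine ⟨by rw [← NNReal.coe_lt_coe]; norm_num, fun K L => ?_⟩
    refine (Metric.hausdorffEDist_iUnion_le).trans (iSup_le fun j => ?_)
    have key : ∀ A B : TopologicalSpace.NonemptyCompacts Plane,
        ∀ x ∈ gasketMap α j '' (A : Set Plane),
        Metric.infEDist x (gasketMap α j '' (B : Set Plane)) ≤
          ((1 / 2 : ℝ≥0) : ℝ≥0∞) * Metric.hausdorffEDist (A : Set Plane) B := by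
      rintro A B _ ⟨x, hx, rfl⟩
      obtain ⟨y, hy, hxy⟩ := B.isCompact.exists_infEDist_eq_edist B.nonempty x
      calc Metric.infEDist (gasketMap α j x) (gasketMap α j '' (B : Set Plane))
          ≤ edist (gasketMap α j x) (gasketMap α j y) :=
            Metric.infEDist_le_edist_of_mem ⟨y, hy, rfl⟩
        _ ≤ ((1 / 2 : ℝ≥0) : ℝ≥0∞) * edist x y := lipschitzWith_gasketMap α j x y
        _ ≤ _ := by
          rw [← hxy]
          gcongr
          exact Metric.infEDist_le_hausdorffEDist_of_mem hx
    refine Metric.hausdorffEDist_le_of_infEDist (key K L) fun x hx => ?_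
    refine (key L K x hx).trans ?_
    rw [Metric.hausdorffEDist_comm]
    rfl
  have : Nonempty (TopologicalSpace.NonemptyCompacts Plane) := ⟨{0}⟩
  refine ⟨ContractingWith.fixedPoint Φ hΦ, ?_, fun K hK => ?_⟩
  · have h : Φ (ContractingWith.fixedPoint Φ hΦ) = ContractingWith.fixedPoint Φ hΦ :=
      hΦ.fixedPoint_isFixedPt
    exact (congrArg (fun K : TopologicalSpace.NonemptyCompacts Plane => (K : Set Plane)) h).symm
  · refine hΦ.fixedPoint_unique ?_
    exact SetLike.coe_injective hK.symm

/-- The stretched Sierpinski gasket `K_α`: the unique non-empty compact subset `K` of the plane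
with `K = F₁(K) ∪ … ∪ F₆(K)`. -/
def gasket (α : Param) : Set Plane := (existsUnique_gasket α).choose

theorem gasket_eq (α : Param) : gasket α = ⋃ j, gasketMap α j '' gasket α :=
  (existsUnique_gasket α).choose_spec.1

theorem isCompact_gasket (α : Param) : IsCompact (gasket α) :=
  (existsUnique_gasket α).choose.isCompact

theorem gasket_nonempty (α : Param) : (gasket α).Nonempty :=
  (existsUnique_gasket α).choose.nonempty

/-- The geodesic distance on a subset of the plane: the infimum of the lengths of the continuous
paths that join two points inside the subset. -/
def geodesicEDist {K : Set Plane} (x y : K) : ℝ≥0∞ :=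
  ⨅ γ : Path x y, eVariationOn (fun t : unitInterval => (γ t : Plane)) univ

/-- The Lipschitz seminorm `Lip_g` with respect to the geodesic distance, in `[0, ∞]`. -/
def geodesicLip {K : Set Plane} (f : K → ℂ) : ℝ≥0∞ :=
  ⨆ (x : K) (y : K) (_ : x ≠ y), edist (f x) (f y) / geodesicEDist x y

/-! ### The edges -/

/-- The edges of all the graph approximations: for every word `w` in three letters, the three
sides of the triangle with vertices `F_w p₁, F_w p₂, F_w p₃`, and the three segments
`F_w (F_{i+3} T)` that join the next smaller triangles. -/
inductive Edge : Type
  | triangle (w : List (Fin 3)) (i : Fin 3)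
  | joining (w : List (Fin 3)) (i : Fin 3)

/-- The map `F_w = F_{w_n} ∘ ⋯ ∘ F_{w_1}` for a word `w = w_1 ⋯ w_n`. -/
def wordMap (α : Param) (w : List (Fin 3)) (x : Plane) : Plane :=
  w.foldl (fun y j => gasketMap α (Fin.castLE (by norm_num) j) y) x

/-- The vertices `p₁, p₂, p₃` of the triangle `T`. -/
def corner (i : Fin 3) : Plane := gasketPoint (Fin.castLE (by norm_num) i)

/-- The map `F_{i+3}`, which sends `T` onto the joining segment inside the side of `T` that is
opposite to the vertex number `i`. -/
def joinMap (α : Param) (i : Fin 3) (x : Plane) : Plane := gasketMap α (Fin.natAdd 3 i) x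

/-- The first endpoint of an edge. The endpoints of the side of `T` opposite to the vertex number
`i` are the vertices number `i + 1` and `i + 2` (mod 3). -/
def edgeStart (α : Param) : Edge → Plane
  | .triangle w i => wordMap α w (corner (i + 1))
  | .joining w i => wordMap α w (joinMap α i (corner (i + 1)))

/-- The second endpoint of an edge. -/
def edgeEnd (α : Param) : Edge → Plane
  | .triangle w i => wordMap α w (corner (i + 2))
  | .joining w i => wordMap α w (joinMap α i (corner (i + 2)))

/-- The length of an edge. -/
def edgeLength (α : Param) (e : Edge) : ℝ := dist (edgeStart α e) (edgeEnd α e)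

theorem gasketMap_lineMap (α : Param) (j : Fin 6) (x y : Plane) (s : ℝ) :
    gasketMap α j (AffineMap.lineMap x y s)
      = AffineMap.lineMap (gasketMap α j x) (gasketMap α j y) s := by
  simp only [gasketMap, AffineMap.lineMap_apply_module', map_sub, map_add, map_smul, smul_sub,
    smul_add]
  module

theorem gasketMap_corner_apply (α : Param) (j : Fin 3) (x : Plane) :
    gasketMap α (Fin.castLE (by norm_num) j) x
      = ((1 - α.1) / 2) • (x - corner j) + corner j := by
  ext k
  fin_cases j <;> fin_cases k <;>
    simp [gasketMap, corner, gasketMatrix, Matrix.toLpLin_apply, Matrix.mulVec, dotProduct,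
      Fin.sum_univ_two]

theorem joinMap_corner_one (α : Param) (i : Fin 3) :
    joinMap α i (corner (i + 1))
      = AffineMap.lineMap (corner (i + 1)) (corner (i + 2)) ((1 - α.1) / 2) := by
  have h3 : √3 * √3 = 3 := Real.mul_self_sqrt (by norm_num)
  have h3' : √3 ^ 2 = 3 := Real.sq_sqrt (by norm_num)
  ext k
  fin_cases i <;> fin_cases k <;>
    simp [joinMap, gasketMap, corner, gasketMatrix, gasketPoint, Matrix.toLpLin_apply,
      Matrix.mulVec, dotProduct, Fin.sum_univ_two, AffineMap.lineMap_apply_module',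
      midpoint_eq_smul_add, Fin.natAdd, Fin.castLE] <;>
    ring_nf <;> simp only [h3'] <;> ring

theorem joinMap_corner_two (α : Param) (i : Fin 3) :
    joinMap α i (corner (i + 2))
      = AffineMap.lineMap (corner (i + 1)) (corner (i + 2)) ((1 + α.1) / 2) := by
  have h3 : √3 * √3 = 3 := Real.mul_self_sqrt (by norm_num)
  have h3' : √3 ^ 2 = 3 := Real.sq_sqrt (by norm_num)
  ext k
  fin_cases i <;> fin_cases k <;>
    simp [joinMap, gasketMap, corner, gasketMatrix, gasketPoint, Matrix.toLpLin_apply,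
      Matrix.mulVec, dotProduct, Fin.sum_univ_two, AffineMap.lineMap_apply_module',
      midpoint_eq_smul_add, Fin.natAdd, Fin.castLE] <;>
    ring_nf <;> simp only [h3'] <;> ring

theorem wordMap_lineMap (α : Param) (w : List (Fin 3)) (x y : Plane) (s : ℝ) :
    wordMap α w (AffineMap.lineMap x y s)
      = AffineMap.lineMap (wordMap α w x) (wordMap α w y) s := by
  induction w generalizing x y with
  | nil => rfl
  | cons j w ih =>
    simp only [wordMap, List.foldl_cons] at ih ⊢
    rw [gasketMap_lineMap, ih]

theorem wordMap_mem (α : Param) (w : List (Fin 3)) {x : Plane} (hx : x ∈ gasket α) :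
    wordMap α w x ∈ gasket α := by
  induction w generalizing x with
  | nil => exact hx
  | cons j w ih =>
    refine ih ?_
    rw [gasket_eq]
    exact mem_iUnion.2 ⟨_, mem_image_of_mem _ hx⟩

theorem dist_wordMap (α : Param) (w : List (Fin 3)) (x y : Plane) :
    dist (wordMap α w x) (wordMap α w y) = ((1 - α.1) / 2) ^ w.length * dist x y := by
  have h1 : 0 ≤ (1 - α.1) / 2 := by have := α.2.2; linarith
  induction w generalizing x y with
  | nil => simp [wordMap]
  | cons j w ih =>
    have := ih (gasketMap α (Fin.castLE (by norm_num) j) x)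
      (gasketMap α (Fin.castLE (by norm_num) j) y)
    simp only [wordMap, List.foldl_cons, List.length_cons] at this ⊢
    rw [this, gasketMap_corner_apply, gasketMap_corner_apply, dist_add_right, dist_smul₀,
      dist_sub_right, Real.norm_of_nonneg h1, pow_succ, mul_assoc]

theorem dist_corner (i : Fin 3) : dist (corner (i + 1)) (corner (i + 2)) = 1 := by
  have h3' : √3 ^ 2 = 3 := Real.sq_sqrt (by norm_num)
  rw [EuclideanSpace.dist_eq]
  fin_cases i <;>
    simp [corner, gasketPoint, Fin.sum_univ_two, Real.dist_eq, sq_abs, Fin.castLE, div_pow, h3'] <;>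
    norm_num

theorem edgeLength_triangle (α : Param) (w : List (Fin 3)) (i : Fin 3) :
    edgeLength α (.triangle w i) = ((1 - α.1) / 2) ^ w.length := by
  simp [edgeLength, edgeStart, edgeEnd, dist_wordMap, dist_corner]

theorem edgeLength_joining (α : Param) (w : List (Fin 3)) (i : Fin 3) :
    edgeLength α (.joining w i) = α.1 * ((1 - α.1) / 2) ^ w.length := by
  have h0 : 0 ≤ α.1 := α.2.1.le
  simp only [edgeLength, edgeStart, edgeEnd, dist_wordMap, joinMap_corner_one, joinMap_corner_two,
    dist_lineMap_lineMap, dist_corner, Real.dist_eq]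
  rw [show (1 - α.1) / 2 - (1 + α.1) / 2 = -α.1 by ring, abs_neg, abs_of_nonneg h0]
  ring

theorem edgeLength_pos (α : Param) (e : Edge) : 0 < edgeLength α e := by
  have h0 : 0 < α.1 := α.2.1
  have h1 : 0 < (1 - α.1) / 2 := by have := α.2.2; linarith
  cases e with
  | triangle w i => rw [edgeLength_triangle]; positivity
  | joining w i => rw [edgeLength_joining]; positivity

theorem side_mem (α : Param) (i : Fin 3) {s : ℝ} (hs : s ∈ Icc (0 : ℝ) 1) :
    AffineMap.lineMap (corner (i + 1)) (corner (i + 2)) s ∈ gasket α := by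
  obtain ⟨k, hk⟩ := gasket_nonempty α
  have hα0 : 0 < α.1 := α.2.1
  have hα1 : α.1 < 1 / 3 := α.2.2
  set P : ℝ → Plane := fun s => AffineMap.lineMap (corner (i + 1)) (corner (i + 2)) s with hP
  have hr : 0 < (1 - α.1) / 2 := by linarith
  -- the side is covered by its images under three of the maps
  have cover : ∀ s ∈ Icc (0 : ℝ) 1, ∃ j : Fin 6, ∃ t ∈ Icc (0 : ℝ) 1,
      P s = gasketMap α j (P t) := by
    intro s hs
    rcases le_total s ((1 - α.1) / 2) with h | h
    · refine ⟨Fin.castLE (by norm_num) (i + 1), s / ((1 - α.1) / 2),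
        ⟨by have := hs.1; positivity, (div_le_one hr).2 h⟩, ?_⟩
      rw [gasketMap_corner_apply]
      simp only [hP, AffineMap.lineMap_apply_module', add_sub_cancel_right, smul_smul]
      rw [mul_div_cancel₀ _ hr.ne']
    rcases le_total s ((1 + α.1) / 2) with h' | h'
    · refine ⟨Fin.natAdd 3 i, (s - (1 - α.1) / 2) / α.1,
        ⟨div_nonneg (by linarith) hα0.le, (div_le_one hα0).2 (by linarith)⟩, ?_⟩
      have := gasketMap_lineMap α (Fin.natAdd 3 i) (corner (i + 1)) (corner (i + 2))
        ((s - (1 - α.1) / 2) / α.1)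
      have h1 := joinMap_corner_one α i
      have h2 := joinMap_corner_two α i
      simp only [joinMap] at h1 h2
      rw [h1, h2] at this
      simp only [hP]
      rw [this]
      simp only [AffineMap.lineMap_apply_module']
      have e : s = (s - (1 - α.1) / 2) / α.1 * ((1 + α.1) / 2 - (1 - α.1) / 2)
          + (1 - α.1) / 2 := by field_simp; ring
      conv_lhs => rw [e]
      module
    · refine ⟨Fin.castLE (by norm_num) (i + 2), (s - (1 + α.1) / 2) / ((1 - α.1) / 2),
        ⟨div_nonneg (by linarith) hr.le, (div_le_one hr).2 (by have := hs.2; linarith)⟩, ?_⟩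
      rw [gasketMap_corner_apply]
      simp only [hP, AffineMap.lineMap_apply_module']
      have e : s = (s - (1 + α.1) / 2) / ((1 - α.1) / 2) * ((1 - α.1) / 2)
          + 1 - (1 - α.1) / 2 := by rw [div_mul_cancel₀ _ hr.ne']; ring
      conv_lhs => rw [e]
      module
  have hPc : Continuous P := by simp only [hP]; fun_prop
  obtain ⟨C, hC⟩ := ((isCompact_Icc (a := (0 : ℝ)) (b := 1)).image hPc).isBounded.subset_closedBall k
  have bound : ∀ n : ℕ, ∀ s ∈ Icc (0 : ℝ) 1,
      Metric.infDist (P s) (gasket α) ≤ (1 / 2) ^ n * C := by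
    intro n
    induction n with
    | zero =>
      intro s hs
      simpa using (Metric.infDist_le_dist_of_mem hk).trans (hC ⟨s, hs, rfl⟩)
    | succ n ih =>
      intro s hs
      obtain ⟨j, t, ht, e⟩ := cover s hs
      obtain ⟨y, hy, hyd⟩ := (isCompact_gasket α).exists_infDist_eq_dist ⟨k, hk⟩ (P t)
      have hy' : gasketMap α j y ∈ gasket α := by
        rw [gasket_eq]; exact mem_iUnion.2 ⟨j, y, hy, rfl⟩
      have h1 := (lipschitzWith_gasketMap α j).dist_le_mul (P t) y
      have h2 := ih t ht
      have h3 := Metric.infDist_le_dist_of_mem (x := P s) hy'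
      rw [e] at h3 ⊢
      rw [hyd] at h2
      rw [pow_succ]
      push_cast at h1
      linarith
  have hlim : Filter.Tendsto (fun n : ℕ => (1 / 2 : ℝ) ^ n * C) Filter.atTop (nhds (0 * C)) :=
    (tendsto_pow_atTop_nhds_zero_of_lt_one (by norm_num) (by norm_num)).mul_const C
  rw [zero_mul] at hlim
  have h0 : Metric.infDist (P s) (gasket α) ≤ 0 := ge_of_tendsto' hlim fun n => bound n s hs
  exact ((isCompact_gasket α).isClosed.mem_iff_infDist_zero ⟨k, hk⟩).2
    (le_antisymm h0 Metric.infDist_nonneg)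

/-- The arclength parametrization of an edge, as a map into the plane. -/
def edgePoint (α : Param) (e : Edge) (t : ℝ) : Plane :=
  (1 / edgeLength α e) • (t • edgeEnd α e + (edgeLength α e - t) • edgeStart α e)

theorem edgePoint_mem (α : Param) (e : Edge) {t : ℝ} (ht : t ∈ Icc 0 (edgeLength α e)) :
    edgePoint α e t ∈ gasket α := by
  have hL := edgeLength_pos α e
  have hs : t / edgeLength α e ∈ Icc (0 : ℝ) 1 :=
    ⟨div_nonneg ht.1 hL.le, (div_le_one hL).2 ht.2⟩
  have h : edgePoint α e t
      = AffineMap.lineMap (edgeStart α e) (edgeEnd α e) (t / edgeLength α e) := by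
    rw [edgePoint, AffineMap.lineMap_apply_module, smul_add, smul_smul, smul_smul, add_comm]
    congr 2 <;> field_simp
  rw [h]
  cases e with
  | triangle w i =>
    simp only [edgeStart, edgeEnd]
    rw [← wordMap_lineMap]
    exact wordMap_mem α w (side_mem α i hs)
  | joining w i =>
    simp only [edgeStart, edgeEnd]
    rw [← wordMap_lineMap, joinMap, joinMap, ← gasketMap_lineMap]
    refine wordMap_mem α w ?_
    rw [gasket_eq]
    exact mem_iUnion.2 ⟨_, mem_image_of_mem _ (side_mem α i hs)⟩

/-- The curve `R_e : [0, L(e)] → K_α`. -/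
def edgeCurve (α : Param) (e : Edge) : C(Icc 0 (edgeLength α e), gasket α) where
  toFun t := ⟨edgePoint α e t, edgePoint_mem α e t.2⟩
  continuous_toFun := by
    refine Continuous.subtype_mk ?_ _
    unfold edgePoint
    fun_prop

/-! ### Operators -/

section Operators

variable {H : Type*} [NormedAddCommGroup H] [InnerProductSpace ℂ H]

/-- The domain `{h | ∑ |c k ⟨b k, h⟩|² < ∞}`. -/
def diagonalDomain {ι : Type*} (b : HilbertBasis ι ℂ H) (c : ι → ℝ) : Submodule ℂ H where
  carrier := {h | Memℓp (fun k => (c k : ℂ) * b.repr h k) 2}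
  zero_mem' := by
    refine (congrArg (fun u => Memℓp u 2) (funext fun k => ?_)).mp
      (zero_memℓp : Memℓp (0 : ι → ℂ) 2)
    simp
  add_mem' := fun {x y} hx hy => by
    refine (congrArg (fun u => Memℓp u 2) (funext fun k => ?_)).mp (Memℓp.add hx hy)
    simp [mul_add]
  smul_mem' := fun a x hx => by
    refine (congrArg (fun u => Memℓp u 2) (funext fun k => ?_)).mp (Memℓp.const_smul hx a)
    simp only [Pi.smul_apply, smul_eq_mul, map_smul, lp.coeFn_smul]
    ring

/-- The sequence of coefficients `c k ⟨b k, h⟩`. -/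
def diagonalCoeff {ι : Type*} (b : HilbertBasis ι ℂ H) (c : ι → ℝ) :
    diagonalDomain b c →ₗ[ℂ] lp (fun _ : ι => ℂ) 2 where
  toFun h := ⟨fun k => (c k : ℂ) * b.repr (h : H) k, h.2⟩
  map_add' x y := by
    refine Subtype.ext (funext fun k => ?_)
    change (c k : ℂ) * b.repr ((x : H) + (y : H)) k
      = (c k : ℂ) * b.repr (x : H) k + (c k : ℂ) * b.repr (y : H) k
    rw [map_add, lp.coeFn_add, Pi.add_apply, mul_add]
  map_smul' a x := by
    refine Subtype.ext (funext fun k => ?_)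
    change (c k : ℂ) * b.repr (a • (x : H)) k = a * ((c k : ℂ) * b.repr (x : H) k)
    rw [map_smul, lp.coeFn_smul, Pi.smul_apply, smul_eq_mul]
    ring

/-- The self-adjoint operator `h ↦ ∑ c k ⟨b k, h⟩ b k` with the real eigenvalues `c k` on the
orthonormal basis `b k`, on its maximal domain `{h | ∑ |c k ⟨b k, h⟩|² < ∞}`. -/
def diagonalOperator {ι : Type*} (b : HilbertBasis ι ℂ H) (c : ι → ℝ) : H →ₗ.[ℂ] H where
  domain := diagonalDomain b c
  toFun := (b.repr.symm.toLinearEquiv : lp (fun _ : ι => ℂ) 2 →ₗ[ℂ] H) ∘ₗ diagonalCoeff b c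

/-- The Hilbert space direct sum of (unbounded) operators `D i`, on the domain of all `h` with
`h i ∈ Dom (D i)` for all `i` and `∑ ‖D i (h i)‖² < ∞`. -/
def directSumOperator {ι : Type*} {E : ι → Type*} [∀ i, NormedAddCommGroup (E i)]
    [∀ i, InnerProductSpace ℂ (E i)] (D : ∀ i, E i →ₗ.[ℂ] E i) : lp E 2 →ₗ.[ℂ] lp E 2 where
  domain :=
    { carrier := {h | ∃ hd : ∀ i, h i ∈ (D i).domain, Memℓp (fun i => D i ⟨h i, hd i⟩) 2}
      zero_mem' := by
        refine ⟨fun i => (D i).domain.zero_mem, ?_⟩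
        refine (congrArg (fun u => Memℓp u 2) (funext fun i => ?_)).mp
          (zero_memℓp : Memℓp (0 : ∀ i, E i) 2)
        exact ((D i).map_zero).symm
      add_mem' := by
        rintro x y ⟨hx, hx'⟩ ⟨hy, hy'⟩
        refine ⟨fun i => (D i).domain.add_mem (hx i) (hy i), ?_⟩
        refine (congrArg (fun u => Memℓp u 2) (funext fun i => ?_)).mp (hx'.add hy')
        exact ((D i).map_add ⟨x i, hx i⟩ ⟨y i, hy i⟩).symm
      smul_mem' := by
        rintro a x ⟨hx, hx'⟩
        refine ⟨fun i => (D i).domain.smul_mem a (hx i), ?_⟩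
        refine (congrArg (fun u => Memℓp u 2) (funext fun i => ?_)).mp (hx'.const_smul a)
        exact ((D i).map_smul a ⟨x i, hx i⟩).symm }
  toFun :=
    { toFun := fun h => ⟨fun i => D i ⟨(h : lp E 2) i, h.2.1 i⟩, h.2.2⟩
      map_add' := fun x y => by
        ext1
        funext i
        exact (D i).map_add ⟨(x : lp E 2) i, x.2.1 i⟩ ⟨(y : lp E 2) i, y.2.1 i⟩
      map_smul' := fun a x => by
        ext1
        funext i
        exact (D i).map_smul a ⟨(x : lp E 2) i, x.2.1 i⟩ }

/-- The commutator `[D, T] = D T - T D` of an unbounded operator `D` and a bounded operator `T`,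
on its natural domain `{h ∈ Dom D | T h ∈ Dom D}`. -/
def commutator (D : H →ₗ.[ℂ] H) (T : H →L[ℂ] H) : H →ₗ.[ℂ] H where
  domain := D.domain ⊓ D.domain.comap (T : H →ₗ[ℂ] H)
  toFun :=
    { toFun := fun h => D ⟨T h, h.2.2⟩ - T (D ⟨h, h.2.1⟩)
      map_add' := fun x y => by
        have h1 := D.map_add ⟨T x, x.2.2⟩ ⟨T y, y.2.2⟩
        have h2 := D.map_add ⟨x, x.2.1⟩ ⟨y, y.2.1⟩
        have e1 : D ⟨T (x + y : _), (x + y).2.2⟩ = D (⟨T x, x.2.2⟩ + ⟨T y, y.2.2⟩) :=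
          congrArg D (Subtype.ext (map_add T (x : H) y))
        have e2 : D ⟨(x + y : _), (x + y).2.1⟩ = D (⟨x, x.2.1⟩ + ⟨y, y.2.1⟩) := rfl
        rw [e1, e2, h1, h2, map_add]
        abel
      map_smul' := fun a x => by
        have h1 := D.map_smul a ⟨T x, x.2.2⟩
        have h2 := D.map_smul a ⟨x, x.2.1⟩
        have e1 : D ⟨T (a • x : _), (a • x).2.2⟩ = D (a • ⟨T x, x.2.2⟩) :=
          congrArg D (Subtype.ext (map_smul T a (x : H)))
        have e2 : D ⟨(a • x : _), (a • x).2.1⟩ = D (a • ⟨x, x.2.1⟩) := rfl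
        rw [e1, e2, h1, h2, map_smul, RingHom.id_apply, smul_sub] }

/-- `[D, T]` is bounded: it is bounded on its natural domain, and this domain is a core of `D`,
i.e. it is dense in `Dom D` for the graph norm (for instance, it is all of `Dom D`). -/
def IsBoundedCommutator (D : H →ₗ.[ℂ] H) (T : H →L[ℂ] H) : Prop :=
  D.HasCore (commutator D T).domain ∧
    ∃ C : ℝ, ∀ h : (commutator D T).domain, ‖commutator D T h‖ ≤ C * ‖(h : H)‖

end Operators

/-! ### The spectral triple of a curve of length `ℓ`

The interval `[-ℓ, ℓ]` with periodic boundary conditions is the circle `AddCircle (2 * ℓ)`, and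
`L²([-ℓ, ℓ], (2ℓ)⁻¹ dx)` is `L²` of its normalized Haar measure. The functions
`exp (iπkx/ℓ)` are the Fourier monomials of this circle. -/

/-- The Hilbert space `L²([-ℓ, ℓ], (2ℓ)⁻¹ dx)`. -/
abbrev CircleL2 (ℓ : ℝ) [Fact (0 < 2 * ℓ)] : Type :=
  Lp ℂ 2 (AddCircle.haarAddCircle (T := 2 * ℓ))

/-- The closure `D` of `-i d/dx` on trigonometric polynomials, with eigenvalues `πk/ℓ`. -/
def circleD (ℓ : ℝ) [Fact (0 < 2 * ℓ)] : CircleL2 ℓ →ₗ.[ℂ] CircleL2 ℓ :=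
  diagonalOperator (fourierBasis (T := 2 * ℓ)) fun k => Real.pi * k / ℓ

/-- The translate `D_ℓ = D + (π/2ℓ) I`, with eigenvalues `(2k+1)π/(2ℓ)`. -/
def curveDirac (ℓ : ℝ) [Fact (0 < 2 * ℓ)] : CircleL2 ℓ →ₗ.[ℂ] CircleL2 ℓ :=
  diagonalOperator (fourierBasis (T := 2 * ℓ)) fun k => (2 * k + 1) * Real.pi / (2 * ℓ)

/-- The folding map `x ↦ |x|` from `[-ℓ, ℓ]` (as a circle) to `[0, ℓ]`. -/
def fold (ℓ : ℝ) [hℓ : Fact (0 < 2 * ℓ)] : C(AddCircle (2 * ℓ), Icc 0 ℓ) where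
  toFun x := ⟨‖x‖, norm_nonneg x, by
    have h := AddCircle.norm_le_half_period (2 * ℓ) (x := x) hℓ.out.ne'
    rw [abs_of_pos hℓ.out] at h
    linarith⟩
  continuous_toFun := by fun_prop

theorem fold_coe (ℓ : ℝ) [hℓ : Fact (0 < 2 * ℓ)] {x : ℝ} (hx : x ∈ Icc (-ℓ) ℓ) :
    (fold ℓ (x : AddCircle (2 * ℓ)) : ℝ) = |x| := by
  refine (AddCircle.norm_coe_eq_abs_iff (2 * ℓ) hℓ.out.ne').2 ?_
  rw [abs_of_pos hℓ.out]
  have := abs_le.2 hx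
  linarith

/-- Multiplication by a continuous function on `L²`. -/
def mulOperator (ℓ : ℝ) [Fact (0 < 2 * ℓ)] (g : C(AddCircle (2 * ℓ), ℂ)) :
    CircleL2 ℓ →L[ℂ] CircleL2 ℓ :=
  (ContinuousLinearMap.mul ℂ ℂ).holderL AddCircle.haarAddCircle ∞ 2 2
    (ContinuousMap.toLp ∞ AddCircle.haarAddCircle ℂ g)

theorem coeFn_mulOperator (ℓ : ℝ) [Fact (0 < 2 * ℓ)] (g : C(AddCircle (2 * ℓ), ℂ))
    (h : CircleL2 ℓ) :
    mulOperator ℓ g h =ᵐ[AddCircle.haarAddCircle] fun x => g x * h x := by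
  have h1 := (ContinuousLinearMap.mul ℂ ℂ).coeFn_holder (r := 2)
    (ContinuousMap.toLp ∞ AddCircle.haarAddCircle ℂ g) h
  filter_upwards [h1, ContinuousMap.coeFn_toLp (p := ∞) (𝕜 := ℂ) AddCircle.haarAddCircle g]
    with x hx hg
  simp only [mulOperator, ContinuousLinearMap.holderL_apply_apply]
  rw [hx, hg]
  rfl

theorem norm_mulOperator_apply_le (ℓ : ℝ) [Fact (0 < 2 * ℓ)] (g : C(AddCircle (2 * ℓ), ℂ))
    (h : CircleL2 ℓ) : ‖mulOperator ℓ g h‖ ≤ ‖g‖ * ‖h‖ := by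
  refine Lp.norm_le_mul_norm_of_ae_le_mul ?_
  filter_upwards [coeFn_mulOperator ℓ g h] with x hx
  rw [hx, norm_mul]
  gcongr
  exact g.norm_coe_le_norm x

/-! ### The spectral triple of the gasket -/

instance edgeFact (α : Param) (e : Edge) : Fact (0 < 2 * edgeLength α e) :=
  ⟨by have := edgeLength_pos α e; linarith⟩

/-- The function `x ↦ f (R_e |x|)` on `[-L(e), L(e)]` (as a circle). -/
def edgePullback (α : Param) (f : C(gasket α, ℂ)) (e : Edge) :
    C(AddCircle (2 * edgeLength α e), ℂ) :=
  (f.comp (edgeCurve α e)).comp (fold (edgeLength α e))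

/-- The Hilbert space `ℋ_α`, the direct sum of the spaces `L²([-L(e), L(e)])` over all edges. -/
abbrev GasketL2 (α : Param) : Type := lp (fun e : Edge => CircleL2 (edgeLength α e)) 2

/-- The operator `D_α`, the direct sum of the operators `D_ℓ`, `ℓ = L(e)`, over all edges. -/
def gasketDirac (α : Param) : GasketL2 α →ₗ.[ℂ] GasketL2 α :=
  directSumOperator fun e => curveDirac (edgeLength α e)

instance compactSpace_gasket (α : Param) : CompactSpace (gasket α) :=
  isCompact_iff_compactSpace.1 (isCompact_gasket α)

theorem norm_edgePullback_le (α : Param) (f : C(gasket α, ℂ)) (e : Edge) :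
    ‖edgePullback α f e‖ ≤ ‖f‖ :=
  (ContinuousMap.norm_le _ (norm_nonneg f)).2 fun _ => f.norm_coe_le_norm _

theorem norm_mul_edgePullback_le (α : Param) (f : C(gasket α, ℂ)) (h : GasketL2 α) (e : Edge) :
    ‖mulOperator _ (edgePullback α f e) (h e)‖ ≤ ‖((‖f‖ : ℂ) • h) e‖ := by
  refine (norm_mulOperator_apply_le _ _ _).trans ?_
  rw [lp.coeFn_smul, Pi.smul_apply, norm_smul, Complex.norm_real, norm_norm]
  gcongr
  exact norm_edgePullback_le α f e

/-- The representation `π_α` of `C(K_α)`: on the summand of the edge `e` the function `f` acts as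
multiplication by `f (R_e |x|)`. -/
def gasketRep (α : Param) (f : C(gasket α, ℂ)) : GasketL2 α →L[ℂ] GasketL2 α :=
  LinearMap.mkContinuous
    { toFun := fun h => ⟨fun e => mulOperator _ (edgePullback α f e) (h e),
        (lp.memℓp ((‖f‖ : ℂ) • h)).mono' (norm_mul_edgePullback_le α f h)⟩
      map_add' := fun x y => by
        ext1
        funext e
        exact map_add (mulOperator _ (edgePullback α f e)) (x e) (y e)
      map_smul' := fun a x => by
        ext1
        funext e
        exact map_smul (mulOperator _ (edgePullback α f e)) a (x e) }
    ‖f‖ (fun h => by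
      have h1 := lp.norm_mono (p := 2) (by norm_num)
        (x := ⟨fun e => mulOperator _ (edgePullback α f e) (h e),
          (lp.memℓp ((‖f‖ : ℂ) • h)).mono' (norm_mul_edgePullback_le α f h)⟩)
        (y := (‖f‖ : ℂ) • h) (norm_mul_edgePullback_le α f h)
      have h2 : ‖(‖f‖ : ℂ) • h‖ = ‖f‖ * ‖h‖ := by
        rw [norm_smul, Complex.norm_real, norm_norm]
      exact h1.trans h2.le)

/-- The `L²` class of the function `x ↦ f (R_e |x|)`. -/
def edgeFunction (α : Param) (f : C(gasket α, ℂ)) (e : Edge) : CircleL2 (edgeLength α e) :=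
  ContinuousMap.toLp 2 AddCircle.haarAddCircle ℂ (edgePullback α f e)

/-- The norm `‖D_α f‖_∞ = sup_e ‖-i d/dx (f (R_e |x|))‖_∞` of a function all of whose pullbacks
to the edges lie in the domain of `-i d/dx`. -/
def derivSupNorm (α : Param) (f : C(gasket α, ℂ))
    (hf : ∀ e, edgeFunction α f e ∈ (circleD (edgeLength α e)).domain) : ℝ≥0∞ :=
  ⨆ e, eLpNorm (circleD (edgeLength α e) ⟨edgeFunction α f e, hf e⟩) ∞ AddCircle.haarAddCircle

end StretchedGasket

end

noncomputable section

namespace StretchedGasket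

open AddCircle ComplexConjugate
open scoped Topology

/-! ### Lengths of paths -/

/-! For finite `K`, each side of the equality is at most `K` exactly when `f` is `K`-Lipschitz in
arclength on every edge. Three facts carry this.

On one circle, let `g` be continuous. The matrix of the commutator of `D` with multiplication by `g`
has entries `π(m-n)/ℓ` times the Fourier coefficient of `g` at `m-n`; adding a constant to `D` does
not change it. Conjugation by the translation group turns this matrix into the derivative of
multiplication by `g(· + t)`. The mean value inequality then bounds the multiplication operator of
`g(· + t) - g` by `C|t|`, and since `g` is continuous this is a pointwise bound
(`norm_translate_sub_le`). The same argument covers a bounded commutator and an essentially bounded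
`Dg`; the converse is Rademacher's theorem on the line (`exists_circleD_of_lipschitz`).

A bounded commutator on the direct sum gives one constant `C` for all edges. Since the bound is
assumed only on a core, it is used weakly, with `D` moved to the other side of the inner product
(`IsBoundedCommutator.exists_norm_inner_sub_le`).

On the gasket, a Lipschitz bound on the edges must control `f` along every path in `K_α`, although a
path may meet points that lie on no edge. A continuous real function which is `M`-Lipschitz on the
edges is therefore approximated uniformly on `K_α` by functions that are locally `M`-Lipschitz
around each point: inside the small cells of level `n` it is replaced by a Lipschitz extension of
its values at the three corners (`exists_local_lipschitz_approx`). For such functions the path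
estimate is a supremum argument (`edist_le_mul_eVariationOn`). Conversely, a piece of an edge is
itself a path whose length is its arclength (`geodesicEDist_edgeCurve_le`). -/

/-- If `f` is locally controlled by `g` around every point of an interval, then the increment of
`f` over the interval is controlled by the variation of `g`. -/
theorem edist_le_mul_eVariationOn {E F : Type*} [PseudoEMetricSpace E] [PseudoEMetricSpace F]
    {f : ℝ → E} {g : ℝ → F} {C : ℝ≥0∞} {a b : ℝ} (hab : a ≤ b)
    (h : ∀ t ∈ Icc a b, ∀ᶠ s in 𝓝[Icc a b] t, edist (f s) (f t) ≤ C * edist (g s) (g t)) :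
    edist (f a) (f b) ≤ C * eVariationOn g (Icc a b) := by
  -- The hypothesis compares `f s` with `f t` for the centre `t` only, so the interval is exhausted
  -- by following the supremum of the good endpoints.
  set S : Set ℝ := {t ∈ Icc a b | edist (f a) (f t) ≤ C * eVariationOn g (Icc a t)} with hS
  have ha : a ∈ S := ⟨left_mem_Icc.2 hab, by simp⟩
  have step : ∀ t ∈ S, ∀ s ∈ Icc a b, t ≤ s → edist (f t) (f s) ≤ C * edist (g t) (g s) →
      s ∈ S := by
    rintro t ⟨ht, ht'⟩ s hs hts hle
    refine ⟨hs, ?_⟩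
    have h1 := eVariationOn.Icc_add_Icc g (s := univ) ht.1 hts (mem_univ t)
    simp only [univ_inter] at h1
    rw [← h1, mul_add]
    refine (edist_triangle _ (f t) _).trans (add_le_add ht' (hle.trans ?_))
    gcongr
    exact eVariationOn.edist_le g (left_mem_Icc.2 hts) (right_mem_Icc.2 hts)
  have hbdd : BddAbove S := ⟨b, fun t ht => ht.1.2⟩
  have hlub := isLUB_csSup ⟨a, ha⟩ hbdd
  set c := sSup S
  have hc : c ∈ Icc a b := ⟨hlub.1 ha, hlub.2 fun t ht => ht.1.2⟩
  -- Points of `S` accumulate at `c` from the left or equal it, so the local bound centred at `c`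
  -- applies to one of them.
  have hcS : c ∈ S := by
    have h1 := hlub.frequently_mem ⟨a, ha⟩
    have h2 := (eventually_nhdsWithin_iff.1 (h c hc)).filter_mono
      (nhdsWithin_le_nhds (a := c) (s := Iic c))
    obtain ⟨t, ⟨htS, ht⟩, htc⟩ := ((h1.and_eventually h2).and_eventually
      self_mem_nhdsWithin).exists
    exact step t htS c hc htc (ht htS.1)
  rcases eq_or_lt_of_le hc.2 with hcb | hcb
  · rw [← hcb]; exact hcS.2
  -- If `c < b`, the local bound to the right of `c` yields a good endpoint beyond the supremum.
  · have h2 := (eventually_nhdsWithin_iff.1 (h c hc)).filter_mono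
      (nhdsWithin_le_nhds (a := c) (s := Ioi c))
    obtain ⟨s, hs, hs'⟩ := (h2.and (Ioo_mem_nhdsGT hcb)).exists
    have hsI : s ∈ Icc a b := ⟨hc.1.trans hs'.1.le, hs'.2.le⟩
    have h3 := hs hsI
    rw [edist_comm, edist_comm (g s)] at h3
    exact absurd (hlub.1 (step c hcS s hsI hs'.1.le h3)) (not_le.2 hs'.1)

/-- A function which is locally `C`-Lipschitz around every point of `K` (as center) varies along a
path in `K` by at most `C` times the length of the path. -/
theorem edist_le_mul_length {E : Type*} [PseudoEMetricSpace E] {K : Set Plane}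
    {u : Plane → E} {C : ℝ≥0}
    (h : ∀ z ∈ K, ∀ᶠ z' in 𝓝[K] z, edist (u z') (u z) ≤ C * edist z' z) {x y : K} (γ : Path x y) :
    edist (u x) (u y) ≤ C * eVariationOn (fun t : unitInterval => (γ t : Plane)) univ := by
  have h1 : ∀ t ∈ Icc (0 : ℝ) 1, ∀ᶠ s in 𝓝[Icc 0 1] t,
      edist (u (γ.extend s)) (u (γ.extend t))
        ≤ C * edist (γ.extend s : Plane) (γ.extend t : Plane) := by
    intro t _
    have hc : Filter.Tendsto (fun s => (γ.extend s : Plane)) (𝓝 t) (𝓝[K] (γ.extend t)) := by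
      refine tendsto_nhdsWithin_iff.2 ⟨?_, Filter.Eventually.of_forall fun s => (γ.extend s).2⟩
      exact (continuous_subtype_val.comp γ.continuous_extend).continuousAt
    exact (hc.eventually (h _ (γ.extend t).2)).filter_mono nhdsWithin_le_nhds
  have h2 := edist_le_mul_eVariationOn (f := fun s => u (γ.extend s))
    (g := fun s => (γ.extend s : Plane)) zero_le_one h1
  simp only [Path.extend_zero, Path.extend_one] at h2
  refine h2.trans ?_
  gcongr
  -- The extended path is the path composed with the monotone projection onto `[0, 1]`, which cannot
  -- increase the variation.
  exact eVariationOn.comp_le_of_monotoneOn (fun t : unitInterval => (γ t : Plane))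
    (projIcc 0 1 zero_le_one) ((monotone_projIcc _).monotoneOn _) (mapsTo_univ _ _)

/-! ### Barycentric coordinates -/

/-- The barycentric coordinates with respect to the triangle `T`. -/
def bary : Fin 3 → Plane → ℝ :=
  ![fun z => 1 - z 0 - z 1 / √3, fun z => 2 * z 1 / √3, fun z => z 0 - z 1 / √3]

theorem continuous_bary (i : Fin 3) : Continuous (bary i) := by
  fin_cases i <;> simp [bary] <;> fun_prop

theorem bary_corner (i j : Fin 3) : bary i (corner j) = if i = j then 1 else 0 := by
  fin_cases i <;> fin_cases j <;> simp [bary, corner, gasketPoint, Fin.castLE] <;> norm_num <;>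
    field_simp <;> norm_num

theorem bary_lineMap (i : Fin 3) (x y : Plane) (t : ℝ) :
    bary i (AffineMap.lineMap x y t) = (1 - t) * bary i x + t * bary i y := by
  fin_cases i <;> simp [bary, AffineMap.lineMap_apply_module] <;> ring

theorem bary_sum (i : Fin 3) (z : Plane) : bary i z + bary (i + 1) z + bary (i + 2) z = 1 := by
  fin_cases i <;> simp [bary] <;> ring

/-- The contraction ratio of the three similarities. -/
abbrev ratio (α : Param) : ℝ := (1 - α.1) / 2

theorem ratio_pos (α : Param) : 0 < ratio α := by have := α.2.2; simp only [ratio]; linarith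

theorem ratio_lt (α : Param) : ratio α < 1 / 2 := by have := α.2.1; simp only [ratio]; linarith

/-- The similarity `F_j`, `j = 1, 2, 3`. -/
abbrev cellMap (α : Param) (j : Fin 3) (x : Plane) : Plane :=
  gasketMap α (Fin.castLE (by norm_num) j) x

theorem cellMap_eq_lineMap (α : Param) (j : Fin 3) (x : Plane) :
    cellMap α j x = AffineMap.lineMap (corner j) x (ratio α) := by
  rw [cellMap, gasketMap_corner_apply, AffineMap.lineMap_apply_module']

theorem bary_cellMap (α : Param) (i j : Fin 3) (x : Plane) :
    bary i (cellMap α j x) = ratio α * bary i x + if i = j then 1 - ratio α else 0 := by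
  rw [cellMap_eq_lineMap, bary_lineMap, bary_corner]
  split_ifs <;> ring

theorem dist_cellMap (α : Param) (j : Fin 3) (x y : Plane) :
    dist (cellMap α j x) (cellMap α j y) = ratio α * dist x y := by
  simpa [wordMap] using dist_wordMap α [j] x y

/-- Orthogonal projection onto a side of `T` remembers only the signed distance to its midpoint,
which is half the difference of the barycentric coordinates of the two endpoints. -/
theorem joinMap_eq_lineMap (α : Param) (i : Fin 3) (x : Plane) :
    joinMap α i x = AffineMap.lineMap (corner (i + 1)) (corner (i + 2))
      (1 / 2 + α.1 / 2 * (bary (i + 2) x - bary (i + 1) x)) := by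
  have h3' : √3 ^ 2 = 3 := Real.sq_sqrt (by norm_num)
  have h3'' : √3 ^ 3 = 3 * √3 := by rw [pow_succ, h3']
  have h0 : √3 ≠ 0 := by positivity
  have h0' : Matrix.vecHead x.ofLp = x 0 := rfl
  have h1' : Matrix.vecHead (Matrix.vecTail x.ofLp) = x 1 := rfl
  ext k
  fin_cases i <;> fin_cases k <;>
    simp [joinMap, gasketMap, corner, gasketMatrix, gasketPoint, Matrix.toLpLin_apply,
      AffineMap.lineMap_apply_module', bary, midpoint_eq_smul_add, Fin.natAdd, Fin.castLE,
      h0', h1'] <;>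
    field_simp <;> (try ring_nf) <;> (try simp only [h3', h3'']) <;> (try ring_nf)

theorem mem_gasket_iff (α : Param) (z : Plane) :
    z ∈ gasket α ↔ (∃ j, ∃ y ∈ gasket α, cellMap α j y = z) ∨
      ∃ i, ∃ y ∈ gasket α, joinMap α i y = z := by
  conv_lhs => rw [gasket_eq]
  simp only [mem_iUnion, mem_image]
  constructor
  · rintro ⟨j, y, hy, rfl⟩
    refine Fin.addCases (m := 3) (n := 3) (fun i => ?_) (fun i => ?_) j
    · exact Or.inl ⟨i, y, hy, rfl⟩
    · exact Or.inr ⟨i, y, hy, rfl⟩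
  · rintro (⟨j, y, hy, rfl⟩ | ⟨i, y, hy, rfl⟩)
    exacts [⟨_, y, hy, rfl⟩, ⟨_, y, hy, rfl⟩]

/-- The gasket lies in `T`. By compactness the least value `m` of all three coordinates is attained,
at the image of some point of the gasket under one of the six maps. If `m < 0`, each of these maps
pushes coordinates that are at least `m` to values strictly above `m`. -/
theorem bary_nonneg (α : Param) {z : Plane} (hz : z ∈ gasket α) (i : Fin 3) : 0 ≤ bary i z := by
  have hα0 : 0 < α.1 := α.2.1
  have hα1 : α.1 < 1 / 3 := α.2.2
  have hmin : ∀ i, ∃ y ∈ gasket α, ∀ y' ∈ gasket α, bary i y ≤ bary i y' := fun i =>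
    (isCompact_gasket α).exists_isMinOn (gasket_nonempty α) (continuous_bary i).continuousOn
  choose y hy hymin using hmin
  obtain ⟨k, -, hk⟩ := Finset.exists_min_image Finset.univ (fun i => bary i (y i))
    Finset.univ_nonempty
  set m := bary k (y k) with hm
  have hle : ∀ i, ∀ x ∈ gasket α, m ≤ bary i x := fun i x hx =>
    (hk i (Finset.mem_univ i)).trans (hymin i x hx)
  suffices 0 ≤ m from this.trans (hle i z hz)
  by_contra! hneg
  rcases (mem_gasket_iff α _).1 (hy k) with ⟨j, x, hx, e⟩ | ⟨j, x, hx, e⟩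
  · have h1 := bary_cellMap α k j x
    rw [e, ← hm] at h1
    have h2 := hle k x hx
    have h3 := ratio_pos α
    have h4 := ratio_lt α
    split_ifs at h1 <;> nlinarith
  · have h1 := joinMap_eq_lineMap α j x
    rw [e] at h1
    rw [h1, bary_lineMap, bary_corner, bary_corner] at hm
    have h2 := hle j x hx
    have h3 := hle (j + 1) x hx
    have h4 := hle (j + 2) x hx
    have h5 := bary_sum j x
    split_ifs at hm <;> nlinarith

/-! ### Approximation of functions on the gasket -/

/-- `h` is `M`-Lipschitz on each edge. -/
def EdgeLipschitz (α : Param) (h : Plane → ℝ) (M : ℝ) : Prop :=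
  ∀ e : Edge, ∀ x ∈ segment ℝ (edgeStart α e) (edgeEnd α e),
    ∀ y ∈ segment ℝ (edgeStart α e) (edgeEnd α e), |h x - h y| ≤ M * dist x y

theorem wordMap_concat (α : Param) (w : List (Fin 3)) (j : Fin 3) (x : Plane) :
    wordMap α (w ++ [j]) x = cellMap α j (wordMap α w x) := by
  simp [wordMap, List.foldl_append]

theorem cellMap_mem_segment (α : Param) (j : Fin 3) {x a b : Plane} (hx : x ∈ segment ℝ a b) :
    cellMap α j x ∈ segment ℝ (cellMap α j a) (cellMap α j b) := by
  rw [segment_eq_image_lineMap] at hx ⊢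
  obtain ⟨t, ht, rfl⟩ := hx
  exact ⟨t, ht, (gasketMap_lineMap α _ a b t).symm⟩

theorem EdgeLipschitz.comp_cellMap {α : Param} {h : Plane → ℝ} {M : ℝ} (hh : EdgeLipschitz α h M)
    (j : Fin 3) : EdgeLipschitz α (fun x => h (cellMap α j x)) (M * ratio α) := by
  intro e x hx y hy
  obtain ⟨e', hs, he⟩ : ∃ e', edgeStart α e' = cellMap α j (edgeStart α e) ∧
      edgeEnd α e' = cellMap α j (edgeEnd α e) := by
    cases e with
    -- Words act from the first letter on, so the appended letter becomes the outermost map.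
    | triangle w i => exact ⟨.triangle (w ++ [j]) i, wordMap_concat .., wordMap_concat ..⟩
    | joining w i => exact ⟨.joining (w ++ [j]) i, wordMap_concat .., wordMap_concat ..⟩
  have h1 := hh e' (cellMap α j x) (by rw [hs, he]; exact cellMap_mem_segment α j hx)
    (cellMap α j y) (by rw [hs, he]; exact cellMap_mem_segment α j hy)
  rwa [dist_cellMap, ← mul_assoc] at h1

theorem cellMap_corner_self (α : Param) (j : Fin 3) : cellMap α j (corner j) = corner j := by
  rw [cellMap_eq_lineMap, AffineMap.lineMap_same_apply]

theorem corner_mem (α : Param) (i : Fin 3) : corner i ∈ gasket α := by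
  have := side_mem α (i + 2) (s := 0) (by simp)
  rwa [AffineMap.lineMap_apply_zero, add_assoc, show (2 + 1 : Fin 3) = 0 from rfl, add_zero] at this

theorem cellMap_mem (α : Param) (j : Fin 3) {x : Plane} (hx : x ∈ gasket α) :
    cellMap α j x ∈ gasket α := (mem_gasket_iff α _).2 (Or.inl ⟨j, x, hx, rfl⟩)

/-- The inverse of `cellMap`. -/
def cellInv (α : Param) (j : Fin 3) (x : Plane) : Plane :=
  AffineMap.lineMap (corner j) x (ratio α)⁻¹

theorem cellInv_cellMap (α : Param) (j : Fin 3) (x : Plane) :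
    cellInv α j (cellMap α j x) = x := by
  have := (ratio_pos α).ne'
  rw [cellInv, cellMap_eq_lineMap, AffineMap.lineMap_lineMap_right, inv_mul_cancel₀ this,
    AffineMap.lineMap_apply_one]

theorem continuous_cellInv (α : Param) (j : Fin 3) : Continuous (cellInv α j) := by
  unfold cellInv; fun_prop

theorem joining_segment (α : Param) (i : Fin 3) :
    segment ℝ (edgeStart α (.joining [] i)) (edgeEnd α (.joining [] i)) =
      AffineMap.lineMap (corner (i + 1)) (corner (i + 2)) '' Icc (ratio α) (1 - ratio α) := by
  have h := ratio_lt α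
  rw [← segment_eq_Icc (by linarith), image_segment]
  simp only [edgeStart, edgeEnd, wordMap, List.foldl_nil, joinMap_corner_one, joinMap_corner_two]
  congr 2
  simp only [ratio]; ring

/-- On the gasket two barycentric coordinates differ by at most one, so the parameter stays within
`α/2` of the midpoint. -/
theorem joinMap_mem_segment (α : Param) (i : Fin 3) {x : Plane} (hx : x ∈ gasket α) :
    joinMap α i x ∈ segment ℝ (edgeStart α (.joining [] i)) (edgeEnd α (.joining [] i)) := by
  rw [joining_segment, joinMap_eq_lineMap]
  refine mem_image_of_mem _ ?_
  have h0 := bary_nonneg α hx i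
  have h1 := bary_nonneg α hx (i + 1)
  have h2 := bary_nonneg α hx (i + 2)
  have h3 := bary_sum i x
  have h4 : 0 < α.1 := α.2.1
  simp only [ratio]
  constructor <;> nlinarith

/-- The three cells are disjoint: as `α > 0`, the threshold exceeds `1/2`, and two coordinates above
it would sum to more than one. -/
theorem eq_of_bary_ge {α : Param} {z : Plane} (hz : z ∈ gasket α) {i j : Fin 3}
    (hi : 1 - ratio α ≤ bary i z) (hj : 1 - ratio α ≤ bary j z) : i = j := by
  have h := ratio_lt α
  have h0 := bary_nonneg α hz 0
  have h1 := bary_nonneg α hz 1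
  have h2 := bary_nonneg α hz 2
  have h3 := bary_sum 0 z
  simp only [zero_add] at h3
  fin_cases i <;> fin_cases j <;> first | rfl | (simp at hi hj; linarith)

theorem bary_cellMap_ge {α : Param} {z : Plane} (hz : z ∈ gasket α) (j : Fin 3) :
    1 - ratio α ≤ bary j (cellMap α j z) := by
  rw [bary_cellMap, if_pos rfl]
  nlinarith [ratio_pos α, bary_nonneg α hz j]

open Classical in
/-- The function which equals `U j ∘ F_j⁻¹` on the cell of `F_j` and `h` away from the cells. -/
def glue (α : Param) (U : Fin 3 → Plane → ℝ) (h : Plane → ℝ) (z : Plane) : ℝ :=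
  if hz : ∃ j, 1 - ratio α ≤ bary j z then U hz.choose (cellInv α hz.choose z) else h z

/-- Disjointness of the cells makes the chosen index independent of the choice. -/
theorem glue_cellMap {α : Param} {U : Fin 3 → Plane → ℝ} {h : Plane → ℝ} {z : Plane}
    (hz : z ∈ gasket α) (j : Fin 3) : glue α U h (cellMap α j z) = U j z := by
  have hex : ∃ i, 1 - ratio α ≤ bary i (cellMap α j z) := ⟨j, bary_cellMap_ge hz j⟩
  have hj : hex.choose = j :=
    eq_of_bary_ge (cellMap_mem α j hz) hex.choose_spec (bary_cellMap_ge hz j)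
  rw [glue, dif_pos hex, hj, cellInv_cellMap]

/-- A joining segment meets the cells only at its two endpoints. These are images of corners, where
the two definitions agree by `hU`. -/
theorem glue_joining {α : Param} {U : Fin 3 → Plane → ℝ} {h : Plane → ℝ}
    (hU : ∀ i j, U j (corner i) = h (cellMap α j (corner i))) {i : Fin 3} {z : Plane}
    (hz : z ∈ segment ℝ (edgeStart α (.joining [] i)) (edgeEnd α (.joining [] i))) :
    glue α U h z = h z := by
  by_cases hex : ∃ j, 1 - ratio α ≤ bary j z
  · obtain ⟨j, hj⟩ := hex
    obtain ⟨k, rfl⟩ : ∃ k, z = cellMap α j (corner k) := by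
      rw [joining_segment] at hz
      obtain ⟨s, ⟨hs, hs'⟩, rfl⟩ := hz
      have hr := ratio_lt α
      rw [bary_lineMap, bary_corner, bary_corner] at hj
      have hcase : j = i ∨ j = i + 1 ∨ j = i + 2 := by
        clear hj
        revert i j; decide
      have n1 : ∀ i : Fin 3, i ≠ i + 1 := by decide
      have n2 : ∀ i : Fin 3, i ≠ i + 2 := by decide
      have n3 : ∀ i : Fin 3, i + 1 ≠ i + 2 := by decide
      rcases hcase with rfl | rfl | rfl
      · rw [if_neg (n1 j), if_neg (n2 j)] at hj
        linarith
      · rw [if_pos rfl, if_neg (n3 i)] at hj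
        refine ⟨i + 2, ?_⟩
        rw [cellMap_eq_lineMap, show s = ratio α by linarith]
      · rw [if_pos rfl, if_neg (n3 i).symm] at hj
        refine ⟨i + 1, ?_⟩
        rw [cellMap_eq_lineMap, show s = 1 - ratio α by linarith, AffineMap.lineMap_apply_one_sub]
    rw [glue_cellMap (corner_mem α k), hU]
  · rw [glue, dif_neg hex]

/-- Self-similarity drives the induction: the cell `F_j` carries `h ∘ F_j`, whose edge constant is
`M` times the ratio, and the rescaled approximations are glued with `h` on the joining segments.
Agreement at the corners is part of the statement so that the glueing is consistent. -/
theorem exists_local_lipschitz_approx (α : Param) (n : ℕ) :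
    ∀ (h : Plane → ℝ) (M : ℝ≥0) (ε : ℝ), 0 ≤ ε → EdgeLipschitz α h M →
      (∀ x ∈ gasket α, ∀ y ∈ gasket α,
        dist x y ≤ ratio α ^ n * Metric.diam (gasket α) → |h x - h y| ≤ ε) →
      ∃ u : Plane → ℝ, (∀ i, u (corner i) = h (corner i)) ∧
        (∀ z ∈ gasket α, ∀ᶠ z' in 𝓝[gasket α] z, |u z' - u z| ≤ M * dist z' z) ∧
        ∀ z ∈ gasket α, |u z - h z| ≤ ε + M * (ratio α ^ n * Metric.diam (gasket α)) := by
  induction n with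
  | zero =>
    intro h M ε hε hM hosc
    have hlip : LipschitzOnWith M h (range corner) := by
      refine LipschitzOnWith.of_dist_le_mul ?_
      rintro _ ⟨i, rfl⟩ _ ⟨j, rfl⟩
      rw [Real.dist_eq]
      -- Two distinct corners are the endpoints of a side of `T`, which is an edge.
      have hcase : i = j ∨ ∃ k, (i = k + 1 ∨ i = k + 2) ∧ (j = k + 1 ∨ j = k + 2) := by
        revert i j; decide
      rcases hcase with rfl | ⟨k, hi, hj⟩
      · simp
      · have key : ∀ l : Fin 3, (l = k + 1 ∨ l = k + 2) → corner l ∈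
            segment ℝ (edgeStart α (.triangle [] k)) (edgeEnd α (.triangle [] k)) := by
          rintro l (rfl | rfl)
          exacts [left_mem_segment _ _ _, right_mem_segment _ _ _]
        exact hM _ _ (key i hi) _ (key j hj)
    -- The real-valued extension keeps the constant `M`. This is why the argument is carried out for
    -- real functions.
    obtain ⟨u, hu, huh⟩ := hlip.extend_real
    refine ⟨u, fun i => (huh (mem_range_self i)).symm, fun z _ => Filter.Eventually.of_forall
      fun z' => hu.dist_le_mul z' z, fun z hz => ?_⟩
    have hd := Metric.dist_le_diam_of_mem (isCompact_gasket α).isBounded hz (corner_mem α 0)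
    have h1 := hu.dist_le_mul z (corner 0)
    have h2 := hosc _ hz _ (corner_mem α 0) (by simpa using hd)
    rw [Real.dist_eq, ← huh (mem_range_self 0)] at h1
    rw [pow_zero, one_mul]
    have h3 := mul_le_mul_of_nonneg_left hd M.2
    rw [abs_sub_comm] at h2
    have h4 := abs_add_le (u z - h (corner 0)) (h (corner 0) - h z)
    rw [sub_add_sub_cancel] at h4
    have h5 : ((M : ℝ)) = M.1 := rfl
    rw [h5] at h1 ⊢
    linarith
  | succ n ih =>
    intro h M ε hε hM hosc
    have hr := ratio_pos α
    have hstep : ∀ j : Fin 3, _ := fun j => ih (fun x => h (cellMap α j x))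
      (M * (ratio α).toNNReal) ε hε
      (by rw [NNReal.coe_mul, Real.coe_toNNReal _ hr.le]; exact hM.comp_cellMap j) (fun x hx y hy hxy =>
        hosc _ (cellMap_mem α j hx) _ (cellMap_mem α j hy) (by
          rw [dist_cellMap, pow_succ', mul_assoc]
          exact mul_le_mul_of_nonneg_left hxy hr.le))
    choose U hUc hUl hUd using hstep
    have hUc' : ∀ i j, U j (corner i) = h (cellMap α j (corner i)) := fun i j => hUc j i
    have hc : ∀ {z : Plane}, z ∈ gasket α → ∀ j, glue α U h (cellMap α j z) = U j z :=
      fun hz j => glue_cellMap hz j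
    refine ⟨glue α U h, fun i => ?_, fun z hz => ?_, fun z hz => ?_⟩
    · conv_lhs => rw [← cellMap_corner_self α i]
      rw [hc (corner_mem α i), hUc', cellMap_corner_self]
    · have hK : gasket α ⊆ (⋃ j, cellMap α j '' gasket α) ∪
          ⋃ i, segment ℝ (edgeStart α (.joining [] i)) (edgeEnd α (.joining [] i)) := by
        intro x hx
        rcases (mem_gasket_iff α x).1 hx with ⟨j, y, hy, rfl⟩ | ⟨i, y, hy, rfl⟩
        · exact Or.inl (mem_iUnion.2 ⟨j, y, hy, rfl⟩)
        · exact Or.inr (mem_iUnion.2 ⟨i, joinMap_mem_segment α i hy⟩)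
      -- The gasket is covered by six closed pieces, and a bound centred at `z` may be checked on
      -- each piece separately. Pieces that miss `z` are absent near `z`.
      refine Filter.Eventually.filter_mono (nhdsWithin_mono z hK) ?_
      rw [nhdsWithin_union, nhdsWithin_iUnion, nhdsWithin_iUnion, Filter.eventually_sup,
        Filter.eventually_iSup, Filter.eventually_iSup]
      refine ⟨fun j => ?_, fun i => ?_⟩
      · by_cases hzj : z ∈ cellMap α j '' gasket α
        · obtain ⟨y, hy, rfl⟩ := hzj
          have ht : Filter.Tendsto (cellInv α j) (𝓝[cellMap α j '' gasket α] (cellMap α j y))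
              (𝓝[gasket α] y) := by
            refine tendsto_nhdsWithin_iff.2 ⟨?_, ?_⟩
            · have := (continuous_cellInv α j).tendsto (cellMap α j y)
              rw [cellInv_cellMap] at this
              exact this.mono_left nhdsWithin_le_nhds
            · filter_upwards [self_mem_nhdsWithin] with x hx
              obtain ⟨x, hx, rfl⟩ := hx
              rwa [cellInv_cellMap]
          filter_upwards [ht.eventually (hUl j y hy), self_mem_nhdsWithin] with x hx hx'
          obtain ⟨x, hxK, rfl⟩ := hx'
          rw [cellInv_cellMap] at hx
          rw [NNReal.coe_mul, Real.coe_toNNReal _ hr.le] at hx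
          rw [hc hxK, hc hy, dist_cellMap, ← mul_assoc]
          exact hx
        · have hcl : IsClosed (cellMap α j '' gasket α) :=
            ((isCompact_gasket α).image (lipschitzWith_gasketMap α _).continuous).isClosed
          rw [← hcl.closure_eq] at hzj
          rw [notMem_closure_iff_nhdsWithin_eq_bot.1 hzj]
          exact Filter.eventually_bot
      · by_cases hzj : z ∈ segment ℝ (edgeStart α (.joining [] i)) (edgeEnd α (.joining [] i))
        · filter_upwards [self_mem_nhdsWithin] with x hx
          rw [glue_joining hUc' hx, glue_joining hUc' hzj]
          exact hM _ x hx z hzj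
        · have hcl : IsClosed
              (segment ℝ (edgeStart α (.joining [] i)) (edgeEnd α (.joining [] i))) := by
            rw [joining_segment]
            exact (isCompact_Icc.image (by fun_prop)).isClosed
          rw [← hcl.closure_eq] at hzj
          rw [notMem_closure_iff_nhdsWithin_eq_bot.1 hzj]
          exact Filter.eventually_bot
    · rcases (mem_gasket_iff α z).1 hz with ⟨j, y, hy, rfl⟩ | ⟨i, y, hy, rfl⟩
      · rw [hc hy]
        refine (hUd j y hy).trans (le_of_eq ?_)
        rw [NNReal.coe_mul, Real.coe_toNNReal _ hr.le]
        ring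
      · rw [glue_joining hUc' (joinMap_mem_segment α i hy), sub_self, abs_zero]
        have := Metric.diam_nonneg (s := gasket α)
        positivity

/-- A continuous function which is `M`-Lipschitz on each edge varies along a path in the gasket by
at most `M` times the length of the path. -/
theorem EdgeLipschitz.edist_le_mul_length {α : Param} {h : Plane → ℝ} {M : ℝ≥0}
    (hh : EdgeLipschitz α h M) (hc : ContinuousOn h (gasket α)) {x y : gasket α} (γ : Path x y) :
    edist (h x) (h y) ≤ M * eVariationOn (fun t : unitInterval => (γ t : Plane)) univ := by
  have hr := ratio_pos α
  have hr' := ratio_lt α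
  refine ENNReal.le_of_forall_pos_le_add fun δ hδ _ => ?_
  have huc := (isCompact_gasket α).uniformContinuousOn_of_continuous hc
  obtain ⟨η, hη, hosc⟩ := Metric.uniformContinuousOn_iff.1 huc (δ / 4) (by positivity)
  have hlim := (tendsto_pow_atTop_nhds_zero_of_lt_one hr.le (by linarith)).mul_const
    (Metric.diam (gasket α))
  rw [zero_mul] at hlim
  have hlim' := hlim.const_mul (M : ℝ)
  rw [mul_zero] at hlim'
  -- At this level the oscillation and the Lipschitz term each cost at most `δ/4`. The error is thus
  -- `δ/2` at each endpoint of the path.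
  obtain ⟨n, hn1, hn2⟩ := ((hlim.eventually_lt_const hη).and
    (hlim'.eventually_lt_const (show (0 : ℝ) < δ / 4 by positivity))).exists
  obtain ⟨u, -, hul, hud⟩ := exists_local_lipschitz_approx α n h M (δ / 4) (by positivity) hh
    fun x hx y hy hxy => (hosc x hx y hy (hxy.trans_lt hn1)).le
  have key : ∀ z ∈ gasket α, edist (h z) (u z) ≤ ENNReal.ofReal (δ / 2) := by
    intro z hz
    rw [edist_dist, Real.dist_eq, abs_sub_comm]
    exact ENNReal.ofReal_le_ofReal ((hud z hz).trans (by linarith))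
  have h1 : edist (u x) (u y) ≤ M * eVariationOn (fun t : unitInterval => (γ t : Plane)) univ := by
    refine StretchedGasket.edist_le_mul_length (fun z hz => ?_) γ
    filter_upwards [hul z hz] with z' hz'
    rw [edist_nndist, edist_nndist, ← ENNReal.coe_mul, ENNReal.coe_le_coe, ← NNReal.coe_le_coe]
    push_cast
    rwa [Real.dist_eq]
  calc edist (h x) (h y) ≤ edist (h x) (u x) + edist (u x) (u y) + edist (u y) (h y) :=
        edist_triangle4 _ _ _ _
    _ ≤ ENNReal.ofReal (δ / 2) + M * eVariationOn (fun t : unitInterval => (γ t : Plane)) univ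
        + ENNReal.ofReal (δ / 2) := by
        gcongr
        · exact key x x.2
        · rw [edist_comm]; exact key y y.2
    _ = _ := by
        rw [add_right_comm, ← ENNReal.ofReal_add (by positivity) (by positivity), add_halves,
          ENNReal.ofReal_coe_nnreal, add_comm]

/-! ### The Lipschitz seminorm and the edges -/

theorem edgePoint_eq_lineMap (α : Param) (e : Edge) (t : ℝ) : edgePoint α e t =
    AffineMap.lineMap (edgeStart α e) (edgeEnd α e) (t / edgeLength α e) := by
  have hL := edgeLength_pos α e
  rw [edgePoint, AffineMap.lineMap_apply_module, smul_add, smul_smul, smul_smul, add_comm]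
  congr 2 <;> field_simp

theorem dist_edgePoint (α : Param) (e : Edge) (s t : ℝ) :
    dist (edgePoint α e s) (edgePoint α e t) = dist s t := by
  have hL := edgeLength_pos α e
  rw [edgePoint_eq_lineMap, edgePoint_eq_lineMap, dist_lineMap_lineMap, Real.dist_eq, Real.dist_eq,
    ← sub_div, abs_div, abs_of_pos hL]
  exact div_mul_cancel₀ _ hL.ne'

theorem exists_edgePoint_eq {α : Param} {e : Edge} {x : Plane}
    (hx : x ∈ segment ℝ (edgeStart α e) (edgeEnd α e)) :
    ∃ t ∈ Icc 0 (edgeLength α e), edgePoint α e t = x := by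
  have hL := edgeLength_pos α e
  rw [segment_eq_image_lineMap] at hx
  obtain ⟨s, hs, rfl⟩ := hx
  refine ⟨s * edgeLength α e, ⟨mul_nonneg hs.1 hL.le, mul_le_of_le_one_left hL.le hs.2⟩, ?_⟩
  rw [edgePoint_eq_lineMap, mul_div_cancel_right₀ _ hL.ne']

/-- The complex case reduces to the real one without loss in the constant by rotating `f x - f y`
onto the positive axis and taking real parts. -/
theorem geodesicLip_le {α : Param} {f : C(gasket α, ℂ)} {M : ℝ≥0}
    (hM : ∀ e, LipschitzWith M fun t => f (edgeCurve α e t)) : geodesicLip f ≤ M := by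
  refine iSup_le fun x => iSup_le fun y => iSup_le fun hxy => ?_
  by_cases htop : geodesicEDist x y = ⊤
  -- Pairs at infinite distance contribute zero to the supremum.
  · simp [htop]
  refine ENNReal.div_le_of_le_mul ?_
  have hP : Nonempty (Path x y) := by
    by_contra hP
    rw [not_nonempty_iff] at hP
    exact htop (iInf_of_empty _)
  rw [geodesicEDist, ENNReal.mul_iInf fun h => absurd h ENNReal.coe_ne_top]
  refine le_iInf fun γ => ?_
  obtain ⟨c, hc, hcn⟩ := RCLike.exists_norm_eq_mul_self (f x - f y)
  let F : Plane → ℂ := Function.extend Subtype.val f 0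
  have hF : ∀ z : gasket α, F z = f z := fun z => Subtype.val_injective.extend_apply f 0 z
  have hre : ∀ z w : Plane, |(c * F z).re - (c * F w).re| ≤ ‖F z - F w‖ := by
    intro z w
    rw [← Complex.sub_re, ← mul_sub]
    refine (Complex.abs_re_le_norm _).trans ?_
    rw [norm_mul, hc, one_mul]
  have hedge : EdgeLipschitz α (fun z => (c * F z).re) M := by
    intro e z hz w hw
    obtain ⟨s, hs, rfl⟩ := exists_edgePoint_eq hz
    obtain ⟨t, ht, rfl⟩ := exists_edgePoint_eq hw
    refine (hre _ _).trans ?_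
    have h1 := (hM e).dist_le_mul ⟨s, hs⟩ ⟨t, ht⟩
    rw [dist_eq_norm, ← hF, ← hF] at h1
    rw [dist_edgePoint]
    exact h1
  have hcont : ContinuousOn (fun z => (c * F z).re) (gasket α) := by
    rw [continuousOn_iff_continuous_domRestrict]
    have : (gasket α).domRestrict (fun z => (c * F z).re) = fun z => (c * f z).re :=
      funext fun z => congrArg (fun v => (c * v).re) (hF z)
    rw [this]
    fun_prop
  refine le_trans (le_of_eq ?_) (hedge.edist_le_mul_length hcont γ)
  rw [edist_dist, edist_dist, dist_eq_norm, Real.dist_eq, ← Complex.sub_re, ← mul_sub, hF, hF, ← hcn]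
  simp

theorem geodesicEDist_edgeCurve_le (α : Param) (e : Edge) (s t : Icc 0 (edgeLength α e)) :
    geodesicEDist (edgeCurve α e s) (edgeCurve α e t) ≤ edist s t := by
  let p : Path s t :=
    { toFun := fun τ => ⟨AffineMap.lineMap (s : ℝ) t (τ : ℝ),
        (convex_Icc 0 (edgeLength α e)).lineMap_mem s.2 t.2 τ.2⟩
      continuous_toFun := by fun_prop
      source' := by simp
      target' := by simp }
  refine (iInf_le _ (p.map (edgeCurve α e).continuous)).trans ?_
  -- The segment is run through at constant speed `|s - t|`, and the parameter interval has
  -- variation one.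
  have hlip : LipschitzWith (nndist s t) fun τ : ℝ =>
      edgePoint α e (AffineMap.lineMap (s : ℝ) t τ) := by
    refine LipschitzWith.of_dist_le_mul fun a b => ?_
    rw [dist_edgePoint, dist_lineMap_lineMap, mul_comm]
    rfl
  refine ((hlip.lipschitzOnWith (s := univ)).comp_eVariationOn_le
    (g := fun τ : unitInterval => (τ : ℝ)) (mapsTo_univ _ _)).trans ?_
  have h1 := ((show MonotoneOn (fun τ : unitInterval => (τ : ℝ)) univ from
    fun _ _ _ _ h => h).eVariationOn_eq (mem_univ 0) (mem_univ 1)).le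
  have h2 : (univ : Set unitInterval) ∩ Icc 0 1 = univ := by
    ext τ; simpa using (show τ ≤ 1 from τ.2.2)
  rw [h2] at h1
  calc _ ≤ (nndist s t : ℝ≥0∞) * ENNReal.ofReal (((1 : unitInterval) : ℝ) - (0 : unitInterval)) := by
        gcongr
    _ = _ := by simp

theorem lipschitzWith_edge {α : Param} {f : C(gasket α, ℂ)} {M : ℝ≥0} (hM : geodesicLip f ≤ M)
    (e : Edge) : LipschitzWith M fun t => f (edgeCurve α e t) := by
  intro s t
  rcases eq_or_ne s t with rfl | hst
  · simp
  have hd := geodesicEDist_edgeCurve_le α e s t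
  -- Every path is at least as long as its chord, so division by the geodesic distance is
  -- legitimate.
  have hd0 : geodesicEDist (edgeCurve α e s) (edgeCurve α e t) ≠ 0 := by
    refine ne_of_gt (lt_of_lt_of_le (edist_pos.2 hst) (le_iInf fun γ => ?_))
    have h1 := eVariationOn.edist_le (fun τ : unitInterval => (γ τ : Plane)) (mem_univ 0)
      (mem_univ 1)
    simp only [Path.source, Path.target] at h1
    refine le_trans (le_of_eq ?_) h1
    rw [edist_dist, edist_dist]
    exact congrArg _ (dist_edgePoint α e s t).symm
  have hne : edgeCurve α e s ≠ edgeCurve α e t := by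
    intro h
    apply hst
    have h1 := dist_edgePoint α e s t
    have h2 : edgePoint α e s = edgePoint α e t := congrArg Subtype.val h
    rw [h2, dist_self] at h1
    exact Subtype.ext (dist_eq_zero.1 h1.symm)
  have h1 : edist (f (edgeCurve α e s)) (f (edgeCurve α e t))
      / geodesicEDist (edgeCurve α e s) (edgeCurve α e t) ≤ M := by
    refine le_trans ?_ hM
    refine le_iSup_of_le (edgeCurve α e s) (le_iSup_of_le (edgeCurve α e t) ?_)
    rw [iSup_pos hne]
  rw [ENNReal.div_le_iff hd0 (ne_top_of_le_ne_top (edist_ne_top _ _) hd)] at h1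
  exact h1.trans (by gcongr)

/-! ### Multiplication operators and translations on the circle -/

section Circle

variable {ℓ : ℝ} [hℓ : Fact (0 < 2 * ℓ)]

/-- The Fourier monomial with index `m` as an element of `L²`. -/
abbrev mono (ℓ : ℝ) [Fact (0 < 2 * ℓ)] (m : ℤ) : CircleL2 ℓ := fourierLp 2 m

theorem inner_mono (m : ℤ) (h : CircleL2 ℓ) : inner ℂ (mono ℓ m) h = fourierCoeff h m := by
  rw [← fourierBasis_repr, HilbertBasis.repr_apply_apply, coe_fourierBasis]

theorem norm_sum_mono (s : Finset ℤ) (a : ℤ → ℂ) :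
    ‖∑ m ∈ s, a m • mono ℓ m‖ = √(∑ m ∈ s, ‖a m‖ ^ 2) := by
  rw [eq_comm, Real.sqrt_eq_iff_eq_sq (by positivity) (norm_nonneg _),
    ← inner_self_eq_norm_sq (𝕜 := ℂ), (orthonormal_fourier (T := 2 * ℓ)).inner_sum]
  simp [← Complex.normSq_eq_norm_sq, Complex.normSq_apply]

/-- Multiplication has a Toeplitz matrix in the Fourier basis; every operator estimate on the circle
is read off from it. -/
theorem inner_mono_mulOperator (g : C(AddCircle (2 * ℓ), ℂ)) (m n : ℤ) :
    inner ℂ (mono ℓ m) (mulOperator ℓ g (mono ℓ n)) = fourierCoeff g (m - n) := by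
  rw [inner_mono, fourierCoeff, fourierCoeff]
  refine integral_congr_ae ?_
  filter_upwards [coeFn_mulOperator ℓ g (mono ℓ n), coeFn_fourierLp 2 n] with x h1 h2
  rw [h1, h2, neg_sub, sub_eq_add_neg, fourier_add, smul_eq_mul, smul_eq_mul]
  ring

theorem inner_sum_mono_mulOperator (g : C(AddCircle (2 * ℓ), ℂ)) (s : Finset ℤ) (a b : ℤ → ℂ) :
    inner ℂ (∑ m ∈ s, a m • mono ℓ m) (mulOperator ℓ g (∑ n ∈ s, b n • mono ℓ n)) =
      ∑ m ∈ s, ∑ n ∈ s, conj (a m) * b n * fourierCoeff g (m - n) := by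
  simp only [map_sum, map_smul, sum_inner, inner_sum, inner_smul_left, inner_smul_right,
    inner_mono_mulOperator, Finset.mul_sum]
  rw [Finset.sum_comm]
  refine Finset.sum_congr rfl fun m _ => ?_
  refine Finset.sum_congr rfl fun n _ => ?_
  ring

/-- Otherwise `|k| > c > C` on a nonempty open set. Such a set has positive Haar measure, and its
indicator violates the operator bound. -/
theorem norm_le_of_norm_mulOperator_le {k : C(AddCircle (2 * ℓ), ℂ)} {C : ℝ}
    (h : ∀ φ, ‖mulOperator ℓ k φ‖ ≤ C * ‖φ‖) (z : AddCircle (2 * ℓ)) : ‖k z‖ ≤ C := by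
  by_contra! hz
  obtain ⟨c, hc, hcz⟩ := exists_between hz
  set U : Set (AddCircle (2 * ℓ)) := {x | c < ‖k x‖} with hU
  have hUo : IsOpen U := isOpen_lt continuous_const (by fun_prop)
  let φ : CircleL2 ℓ := indicatorConstLp 2 hUo.measurableSet (measure_ne_top haarAddCircle U) (1 : ℂ)
  have hpos : 0 < haarAddCircle U := hUo.measure_pos _ ⟨z, hcz⟩
  have hφ : 0 < ‖φ‖ := by
    rw [norm_pos_iff]
    intro h0
    have h1 := norm_indicatorConstLp (p := 2) (μ := haarAddCircle) (hs := hUo.measurableSet)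
      (hμs := measure_ne_top haarAddCircle U) (c := (1 : ℂ)) (by norm_num) (by norm_num)
    rw [show indicatorConstLp 2 hUo.measurableSet (measure_ne_top haarAddCircle U) (1 : ℂ) = 0
      from h0, norm_zero, norm_one, one_mul] at h1
    have h2 : 0 < haarAddCircle.real U := ENNReal.toReal_pos hpos.ne' (measure_ne_top _ _)
    have h3 := Real.rpow_pos_of_pos h2 (1 / (2 : ℝ≥0∞).toReal)
    linarith
  have hle : ‖(c : ℂ) • φ‖ ≤ 1 * ‖mulOperator ℓ k φ‖ := by
    refine Lp.norm_le_mul_norm_of_ae_le_mul ?_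
    filter_upwards [coeFn_mulOperator ℓ k φ, Lp.coeFn_smul (c : ℂ) φ,
      indicatorConstLp_coeFn (p := 2) (hs := hUo.measurableSet)
        (hμs := measure_ne_top haarAddCircle U) (c := (1 : ℂ))] with x h1 h2 h3
    rw [h1, h2, one_mul, Pi.smul_apply, norm_smul, norm_mul, Complex.norm_real, Real.norm_eq_abs]
    rw [show φ x = U.indicator (fun _ => 1) x from h3]
    by_cases hx : x ∈ U
    · have hc0 : 0 ≤ C := by
        have := (norm_nonneg _).trans (h φ)
        exact nonneg_of_mul_nonneg_left this hφ
      rw [indicator_of_mem hx, abs_of_nonneg (hc0.trans hc.le)]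
      gcongr
      exact le_of_lt hx
    · simp [hx]
  have h4 := h φ
  have hc0 : 0 ≤ C := nonneg_of_mul_nonneg_left ((norm_nonneg _).trans h4) hφ
  rw [norm_smul, Complex.norm_real, Real.norm_of_nonneg (hc0.trans hc.le), one_mul] at hle
  nlinarith

/-- The hypothesis bounds the sesquilinear form on trigonometric polynomials, which are dense; the
bound extends in one argument at a time. -/
theorem norm_mulOperator_le_of_sum {k : C(AddCircle (2 * ℓ), ℂ)} {C : ℝ}
    (h : ∀ (s : Finset ℤ) (a b : ℤ → ℂ),
      ‖∑ m ∈ s, ∑ n ∈ s, conj (a m) * b n * fourierCoeff k (m - n)‖ ≤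
        C * √(∑ m ∈ s, ‖a m‖ ^ 2) * √(∑ n ∈ s, ‖b n‖ ^ 2)) (φ : CircleL2 ℓ) :
    ‖mulOperator ℓ k φ‖ ≤ C * ‖φ‖ := by
  have hdense : Dense (Submodule.span ℂ (range (mono ℓ)) : Set (CircleL2 ℓ)) :=
    Submodule.dense_iff_topologicalClosure_eq_top.2 (span_fourierLp_closure_eq_top (by norm_num))
  have h1 : ∀ ψ ∈ Submodule.span ℂ (range (mono ℓ)), ∀ φ ∈ Submodule.span ℂ (range (mono ℓ)),
      ‖inner ℂ ψ (mulOperator ℓ k φ)‖ ≤ C * ‖ψ‖ * ‖φ‖ := by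
    intro ψ hψ φ hφ
    obtain ⟨a, rfl⟩ := Finsupp.mem_span_range_iff_exists_finsupp.1 hψ
    obtain ⟨b, rfl⟩ := Finsupp.mem_span_range_iff_exists_finsupp.1 hφ
    rw [Finsupp.sum_of_support_subset a (Finset.subset_union_left (s₂ := b.support)) _ (by simp),
      Finsupp.sum_of_support_subset b (Finset.subset_union_right (s₁ := a.support)) _ (by simp),
      inner_sum_mono_mulOperator, norm_sum_mono, norm_sum_mono]
    exact h _ _ _
  have h2 : ∀ ψ, ∀ φ ∈ Submodule.span ℂ (range (mono ℓ)),
      ‖inner ℂ ψ (mulOperator ℓ k φ)‖ ≤ C * ‖ψ‖ * ‖φ‖ := fun ψ φ hφ =>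
    hdense.induction (P := fun ψ => ‖inner ℂ ψ (mulOperator ℓ k φ)‖ ≤ C * ‖ψ‖ * ‖φ‖)
      (fun ψ hψ => h1 ψ hψ φ hφ) (isClosed_le (by fun_prop) (by fun_prop)) ψ
  have h3 : ∀ ψ φ, ‖inner ℂ ψ (mulOperator ℓ k φ)‖ ≤ C * ‖ψ‖ * ‖φ‖ := fun ψ φ =>
    hdense.induction (P := fun φ => ‖inner ℂ ψ (mulOperator ℓ k φ)‖ ≤ C * ‖ψ‖ * ‖φ‖)
      (fun φ hφ => h2 ψ φ hφ) (isClosed_le (by fun_prop) (by fun_prop)) φ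
  have h4 := h3 (mulOperator ℓ k φ) φ
  rw [inner_self_eq_norm_sq_to_K, norm_pow, RCLike.norm_ofReal, abs_norm] at h4
  rcases (norm_nonneg (mulOperator ℓ k φ)).eq_or_lt' with h0 | h0
  · rw [h0]
    have h5 := h {0} (fun _ => 1) (fun _ => 1)
    have hC : 0 ≤ C := by simpa using (norm_nonneg _).trans h5
    positivity
  · nlinarith

/-- The translate `z ↦ g (z + t)`. -/
def translate (g : C(AddCircle (2 * ℓ), ℂ)) (t : ℝ) : C(AddCircle (2 * ℓ), ℂ) :=
  g.comp ⟨fun z => z + (t : AddCircle (2 * ℓ)), by fun_prop⟩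

theorem fourierCoeff_translate (g : C(AddCircle (2 * ℓ), ℂ)) (t : ℝ) (m : ℤ) :
    fourierCoeff (translate g t) m =
      Complex.exp (Complex.I * (Real.pi * m / ℓ : ℝ) * t) * fourierCoeff g m := by
  have hℓ0 : ℓ ≠ 0 := by have := hℓ.out; intro h; simp [h] at this
  have he : fourier m (t : AddCircle (2 * ℓ)) =
      Complex.exp (Complex.I * (Real.pi * m / ℓ : ℝ) * t) := by
    rw [fourier_coe_apply]
    congr 1
    push_cast
    field_simp
  rw [fourierCoeff, fourierCoeff, ← he,
    ← integral_add_right_eq_self (μ := haarAddCircle) (fun z => fourier (-m) z • g z)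
      (t : AddCircle (2 * ℓ)), ← integral_const_mul]
  refine integral_congr_ae (Filter.Eventually.of_forall fun z => ?_)
  have h1 : fourier (-m) (z + (t : AddCircle (2 * ℓ))) =
      fourier (-m) z * conj (fourier m (t : AddCircle (2 * ℓ))) := by
    rw [← fourier_neg, fourier_apply, fourier_apply, fourier_apply, smul_add, toCircle_add]
    rfl
  have h2 : fourier m (t : AddCircle (2 * ℓ)) * conj (fourier m (t : AddCircle (2 * ℓ))) = 1 := by
    rw [Complex.mul_conj, Complex.normSq_eq_norm_sq, fourier_apply, Circle.norm_coe]
    simp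
  simp only [translate, ContinuousMap.comp_apply, ContinuousMap.coe_mk, smul_eq_mul]
  rw [h1]
  linear_combination (- fourier (-m) z * g (z + (t : AddCircle (2 * ℓ)))) * h2

/-- If the commutator of multiplication by `g` with the derivative is bounded by `C` on
trigonometric polynomials, then `g` is `C`-Lipschitz. -/
theorem norm_translate_sub_le {g : C(AddCircle (2 * ℓ), ℂ)} {C : ℝ}
    (h : ∀ (s : Finset ℤ) (a b : ℤ → ℂ),
      ‖∑ m ∈ s, ∑ n ∈ s, conj (a m) * b n *
        (((Real.pi * (m - n : ℤ) / ℓ : ℝ) : ℂ) * fourierCoeff g (m - n))‖ ≤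
        C * √(∑ m ∈ s, ‖a m‖ ^ 2) * √(∑ n ∈ s, ‖b n‖ ^ 2)) (z : AddCircle (2 * ℓ)) (t : ℝ) :
    ‖g (z + (t : AddCircle (2 * ℓ))) - g z‖ ≤ C * |t| := by
  refine norm_le_of_norm_mulOperator_le (k := translate g t - g)
    (norm_mulOperator_le_of_sum fun s a b => ?_) z
  have hcoeff : ∀ m, fourierCoeff (translate g t - g) m =
      (Complex.exp (Complex.I * (Real.pi * m / ℓ : ℝ) * t) - 1) * fourierCoeff g m := by
    intro m
    rw [sub_mul, ← fourierCoeff_translate, one_mul]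
    simp only [fourierCoeff, ContinuousMap.coe_sub, Pi.sub_apply, smul_sub]
    have hint : ∀ k : C(AddCircle (2 * ℓ), ℂ),
        Integrable (fun z => fourier (-m) z • k z) haarAddCircle := fun k =>
      Continuous.integrable_of_hasCompactSupport (by fun_prop) (HasCompactSupport.of_compactSpace _)
    exact integral_sub (hint _) (hint _)
  -- This is the form of multiplication by `g(· + τ)`; its derivative has the commutator entries, up
  -- to the factor `i` and a phase.
  let F : ℝ → ℂ := fun τ => ∑ m ∈ s, ∑ n ∈ s, conj (a m) * b n *
    (Complex.exp (Complex.I * (Real.pi * (m - n : ℤ) / ℓ : ℝ) * τ) * fourierCoeff g (m - n))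
  let F' : ℝ → ℂ := fun τ => ∑ m ∈ s, ∑ n ∈ s, conj (a m) * b n *
    (Complex.exp (Complex.I * (Real.pi * (m - n : ℤ) / ℓ : ℝ) * τ) *
      (Complex.I * (Real.pi * (m - n : ℤ) / ℓ : ℝ)) * fourierCoeff g (m - n))
  have hF : ∀ τ, HasDerivAt F (F' τ) τ := by
    intro τ
    refine HasDerivAt.fun_sum fun m _ => HasDerivAt.fun_sum fun n _ => ?_
    refine HasDerivAt.const_mul _ (HasDerivAt.mul_const ?_ _)
    have h1 := ((hasDerivAt_id τ).ofReal_comp.const_mul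
      (Complex.I * (Real.pi * (m - n : ℤ) / ℓ : ℝ))).cexp
    simpa using h1
  set A := √(∑ m ∈ s, ‖a m‖ ^ 2)
  set B := √(∑ n ∈ s, ‖b n‖ ^ 2)
  have hF' : ∀ τ, ‖F' τ‖ ≤ C * A * B := by
    intro τ
    -- The phase of the entry `(m, n)` splits as `conj (w m) * w n`. Being unimodular, it is
    -- absorbed into `a` and `b` without changing their norms.
    let w : ℤ → ℂ := fun m => Complex.exp (-((Real.pi * m / ℓ * τ : ℝ) * Complex.I))
    have hw : ∀ m, ‖w m‖ = 1 := fun m => by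
      simp only [w]
      rw [← neg_mul, ← Complex.ofReal_neg, Complex.norm_exp_ofReal_mul_I]
    have h1 := h s (fun m => a m * w m) (fun n => b n * w n)
    simp only [norm_mul, hw, mul_one] at h1
    have h2 : F' τ = Complex.I * ∑ m ∈ s, ∑ n ∈ s, conj (a m * w m) * (b n * w n) *
        (((Real.pi * (m - n : ℤ) / ℓ : ℝ) : ℂ) * fourierCoeff g (m - n)) := by
      simp only [F', Finset.mul_sum]
      refine Finset.sum_congr rfl fun m _ => Finset.sum_congr rfl fun n _ => ?_
      have h3 : Complex.exp (Complex.I * (Real.pi * (m - n : ℤ) / ℓ : ℝ) * τ) =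
          conj (w m) * w n := by
        simp only [w]
        rw [← Complex.exp_conj, ← Complex.exp_add]
        congr 1
        simp only [map_neg, map_mul, Complex.conj_ofReal, Complex.conj_I]
        push_cast
        ring
      rw [h3, map_mul]
      ring
    rw [h2, norm_mul, Complex.norm_I, one_mul]
    exact h1
  have hmvt := convex_univ.norm_image_sub_le_of_norm_hasDerivWithin_le
    (fun τ _ => (hF τ).hasDerivWithinAt) (fun τ _ => hF' τ) (mem_univ 0) (mem_univ t)
  have hsum : F t - F 0 = ∑ m ∈ s, ∑ n ∈ s, conj (a m) * b n *
      fourierCoeff (translate g t - g) (m - n) := by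
    simp only [F, ← Finset.sum_sub_distrib, hcoeff]
    refine Finset.sum_congr rfl fun m _ => Finset.sum_congr rfl fun n _ => ?_
    simp only [Complex.ofReal_zero, mul_zero, Complex.exp_zero]
    ring
  rw [← hsum]
  rw [sub_zero, Real.norm_eq_abs] at hmvt
  linarith

end Circle

/-! ### Diagonal operators and the derivative on the circle -/

theorem repr_diagonalOperator {H ι : Type*} [NormedAddCommGroup H] [InnerProductSpace ℂ H]
    (b : HilbertBasis ι ℂ H) (c : ι → ℝ) (x : (diagonalOperator b c).domain) (k : ι) :
    b.repr (diagonalOperator b c x) k = c k * b.repr (x : H) k := by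
  have h : b.repr (diagonalOperator b c x) = diagonalCoeff b c x := b.repr.apply_symm_apply _
  rw [h]
  rfl

theorem exists_diagonalOperator_eq {H ι : Type*} [NormedAddCommGroup H] [InnerProductSpace ℂ H]
    {b : HilbertBasis ι ℂ H} {c : ι → ℝ} {x y : H} (h : ∀ k, b.repr y k = c k * b.repr x k) :
    ∃ hx : x ∈ (diagonalOperator b c).domain, diagonalOperator b c ⟨x, hx⟩ = y := by
  have hx : x ∈ (diagonalOperator b c).domain := by
    refine (congrArg (fun u => Memℓp u 2) (funext fun k => ?_)).mp (lp.memℓp (b.repr y))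
    exact h k
  refine ⟨hx, b.repr.injective (lp.ext (funext fun k => ?_))⟩
  rw [repr_diagonalOperator, h]

theorem exists_diagonalOperator_sum_eq {H ι : Type*} [NormedAddCommGroup H]
    [InnerProductSpace ℂ H] (b : HilbertBasis ι ℂ H) (c : ι → ℝ) (s : Finset ι) (a : ι → ℂ) :
    ∃ hx : ∑ m ∈ s, a m • b m ∈ (diagonalOperator b c).domain,
      diagonalOperator b c ⟨_, hx⟩ = ∑ m ∈ s, (c m * a m) • b m := by
  refine exists_diagonalOperator_eq fun k => ?_
  simp only [HilbertBasis.repr_apply_apply, inner_sum, inner_smul_right, Finset.mul_sum]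
  refine Finset.sum_congr rfl fun m _ => ?_
  classical
  rw [orthonormal_iff_ite.1 b.orthonormal k m]
  split_ifs with hkm
  · rw [hkm]; ring
  · simp

/-- As the eigenvalues are real, finite combinations of basis vectors lie in the domain of the
adjoint. The weak commutator bound is tested on them. -/
theorem inner_diagonalOperator_sum {H ι : Type*} [NormedAddCommGroup H] [InnerProductSpace ℂ H]
    (b : HilbertBasis ι ℂ H) (c : ι → ℝ) (s : Finset ι) (a : ι → ℂ)
    (x : (diagonalOperator b c).domain) :
    inner ℂ (∑ m ∈ s, (c m * a m) • b m) (x : H) =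
      inner ℂ (∑ m ∈ s, a m • b m) (diagonalOperator b c x) := by
  simp only [sum_inner, inner_smul_left, ← HilbertBasis.repr_apply_apply, repr_diagonalOperator,
    map_mul, Complex.conj_ofReal]
  exact Finset.sum_congr rfl fun m _ => by ring

section Circle

variable {ℓ : ℝ} [hℓ : Fact (0 < 2 * ℓ)]

/-- A continuous function in the domain of `D` whose derivative is essentially bounded by `M` is
`M`-Lipschitz. -/
theorem norm_translate_sub_le_of_circleD {g : C(AddCircle (2 * ℓ), ℂ)}
    (hg : ContinuousMap.toLp 2 haarAddCircle ℂ g ∈ (circleD ℓ).domain) {M : ℝ≥0}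
    (hM : eLpNorm (circleD ℓ ⟨_, hg⟩) ∞ haarAddCircle ≤ M) (z : AddCircle (2 * ℓ)) (t : ℝ) :
    ‖g (z + (t : AddCircle (2 * ℓ))) - g z‖ ≤ M * |t| := by
  set G := circleD ℓ ⟨_, hg⟩ with hG
  have hcoeff : ∀ m : ℤ, fourierCoeff G m = ((Real.pi * m / ℓ : ℝ) : ℂ) * fourierCoeff g m := by
    intro m
    have h := repr_diagonalOperator (fourierBasis (T := 2 * ℓ)) (fun k : ℤ => Real.pi * k / ℓ)
      ⟨_, hg⟩ m
    rwa [fourierBasis_repr, fourierBasis_repr, fourierCoeff_toLp] at h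
  have hGm : MemLp G ∞ haarAddCircle :=
    ⟨(Lp.memLp G).1, hM.trans_lt ENNReal.coe_lt_top⟩
  -- Multiplication by `G = Dg` has norm at most `M`, and its matrix is exactly that of the
  -- commutator of `D` with `g`.
  let T : CircleL2 ℓ → CircleL2 ℓ := fun φ =>
    (ContinuousLinearMap.mul ℂ ℂ).holderL haarAddCircle ∞ 2 2 hGm.toLp φ
  have hT : ∀ φ, ‖T φ‖ ≤ M * ‖φ‖ := by
    intro φ
    refine ((ContinuousLinearMap.mul ℂ ℂ).norm_holder_apply_apply_le hGm.toLp φ).trans ?_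
    gcongr
    rw [Lp.norm_toLp]
    have h1 : (eLpNorm G ∞ haarAddCircle).toReal ≤ M := ENNReal.toReal_le_coe_of_le_coe hM
    have h2 := ContinuousLinearMap.opNorm_mul_le ℂ ℂ
    nlinarith [ENNReal.toReal_nonneg (a := eLpNorm G ∞ haarAddCircle)]
  have hmono : ∀ m n : ℤ, inner ℂ (mono ℓ m) (T (mono ℓ n)) = fourierCoeff G (m - n) := by
    intro m n
    rw [inner_mono, fourierCoeff, fourierCoeff]
    refine integral_congr_ae ?_
    filter_upwards [(ContinuousLinearMap.mul ℂ ℂ).coeFn_holder (r := 2) hGm.toLp (mono ℓ n),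
      coeFn_fourierLp 2 n, hGm.coeFn_toLp] with x h1 h2 h3
    have h4 : T (mono ℓ n) x = G x * fourier n x := by
      simp only [T, ContinuousLinearMap.holderL_apply_apply]
      rw [h1, h2, h3]
      rfl
    rw [h4, neg_sub, sub_eq_add_neg, fourier_add, smul_eq_mul, smul_eq_mul]
    ring
  refine norm_translate_sub_le (fun s a b => ?_) z t
  have hsum : ∑ m ∈ s, ∑ n ∈ s, conj (a m) * b n *
      (((Real.pi * (m - n : ℤ) / ℓ : ℝ) : ℂ) * fourierCoeff g (m - n)) =
      inner ℂ (∑ m ∈ s, a m • mono ℓ m) (T (∑ n ∈ s, b n • mono ℓ n)) := by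
    simp only [T, map_sum, map_smul, sum_inner, inner_sum, inner_smul_left, inner_smul_right,
      Finset.mul_sum]
    rw [Finset.sum_comm]
    refine Finset.sum_congr rfl fun n _ => Finset.sum_congr rfl fun m _ => ?_
    rw [← hcoeff, ← hmono]
    simp only [T]
    ring
  rw [hsum]
  refine (norm_inner_le_norm _ _).trans ?_
  refine (mul_le_mul_of_nonneg_left (hT _) (norm_nonneg _)).trans (le_of_eq ?_)
  rw [norm_sum_mono, norm_sum_mono]
  ring

theorem ae_haarAddCircle_of_ae {P : AddCircle (2 * ℓ) → Prop} (hP : MeasurableSet {z | P z})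
    (h : ∀ᵐ x : ℝ, P (x : AddCircle (2 * ℓ))) : ∀ᵐ z ∂(haarAddCircle (T := 2 * ℓ)), P z := by
  have hvol : ∀ᵐ z : AddCircle (2 * ℓ), P z := by
    have hmp := AddCircle.measurePreserving_mk (2 * ℓ) 0
    rw [← hmp.map_eq, ae_map_iff hmp.measurable.aemeasurable hP]
    exact ae_restrict_of_ae h
  rw [volume_eq_smul_haarAddCircle] at hvol
  exact (Measure.ae_ennreal_smul_measure_iff (ENNReal.ofReal_pos.2 hℓ.out).ne').1 hvol

/-- A `K`-Lipschitz function on the circle lies in the domain of `D`, and its derivative is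
essentially bounded by `K`. -/
theorem exists_circleD_of_lipschitz {g : C(AddCircle (2 * ℓ), ℂ)} {K : ℝ≥0}
    (hK : ∀ (z : AddCircle (2 * ℓ)) (t : ℝ), ‖g (z + (t : AddCircle (2 * ℓ))) - g z‖ ≤ K * |t|) :
    ∃ hg : ContinuousMap.toLp 2 haarAddCircle ℂ g ∈ (circleD ℓ).domain,
      eLpNorm (circleD ℓ ⟨_, hg⟩) ∞ haarAddCircle ≤ K := by
  let F : AddCircle (2 * ℓ) → ℝ → ℂ := fun z t => g (z + (t : AddCircle (2 * ℓ)))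
  have hFc : Continuous F.uncurry := by
    have : Continuous fun p : AddCircle (2 * ℓ) × ℝ => g (p.1 + (p.2 : AddCircle (2 * ℓ))) := by
      have h1 : Continuous fun x : ℝ => (x : AddCircle (2 * ℓ)) := AddCircle.continuous_mk' _
      fun_prop
    exact this
  have hFlip : ∀ z, LipschitzWith K (F z) := fun z => by
    refine LipschitzWith.of_dist_le_mul fun s t => ?_
    have h1 := hK (z + (t : AddCircle (2 * ℓ))) (s - t)
    rw [add_assoc, ← AddCircle.coe_add, add_sub_cancel] at h1
    rw [dist_eq_norm, Real.dist_eq]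
    exact h1
  -- Differentiating in a real parameter at each point `z` gives a measurable function on the
  -- circle, bounded by `K` everywhere: `deriv` is zero where the derivative fails to exist.
  let G : AddCircle (2 * ℓ) → ℂ := fun z => deriv (F z) 0
  have hGmeas : Measurable G :=
    (measurable_deriv_with_param hFc).comp (measurable_id.prodMk measurable_const)
  have hGb : ∀ z, ‖G z‖ ≤ K := fun z => norm_deriv_le_of_lipschitz (hFlip z)
  have hdiff : ∀ᵐ z ∂(haarAddCircle (T := 2 * ℓ)), DifferentiableAt ℝ (F z) 0 := by
    refine ae_haarAddCircle_of_ae ?_ ?_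
    · exact (measurableSet_of_differentiableAt_with_param ℝ hFc).preimage
        (measurable_id.prodMk measurable_const)
    -- Rademacher's theorem for the lift of `g` to the line.
    · filter_upwards [(hFlip 0).ae_differentiableAt_real] with x hx
      have h1 : F (x : AddCircle (2 * ℓ)) = fun t => F 0 (x + t) := by
        funext t
        simp [F]
      rw [h1]
      have h2 : DifferentiableAt ℝ (F 0) (x + 0) := by rwa [add_zero]
      exact (HasDerivAt.comp_const_add x 0 h2.hasDerivAt).differentiableAt
  have hcoeff : ∀ m : ℤ, fourierCoeff G m =
      Complex.I * ((Real.pi * m / ℓ : ℝ) : ℂ) * fourierCoeff g m := by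
    intro m
    -- The Fourier coefficients of the difference quotients are evaluated in two ways: by dominated
    -- convergence, and below by differentiating the phase of a translate.
    have hlim1 : Filter.Tendsto (fun t : ℝ => ∫ z, fourier (-m) z • slope (F z) 0 t ∂haarAddCircle)
        (𝓝[≠] 0) (𝓝 (fourierCoeff G m)) := by
      refine tendsto_integral_filter_of_dominated_convergence (fun _ => (K : ℝ)) ?_ ?_
        (integrable_const _) ?_
      · refine Filter.Eventually.of_forall fun t => Continuous.aestronglyMeasurable ?_
        simp only [slope_def_module, F]
        fun_prop
      · refine Filter.Eventually.of_forall fun t => Filter.Eventually.of_forall fun z => ?_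
        rw [norm_smul, fourier_apply, Circle.norm_coe, one_mul, slope_def_module, norm_smul,
          norm_inv, sub_zero]
        have h1 := (hFlip z).dist_le_mul t 0
        rw [dist_eq_norm, dist_eq_norm, sub_zero] at h1
        rcases eq_or_ne t 0 with rfl | ht
        · simp
        · rw [inv_mul_le_iff₀ (norm_pos_iff.2 ht), mul_comm]
          exact h1
      · filter_upwards [hdiff] with z hz
        exact hz.hasDerivAt.tendsto_slope.const_smul _
    have hlim2 : Filter.Tendsto (fun t : ℝ => ∫ z, fourier (-m) z • slope (F z) 0 t ∂haarAddCircle)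
        (𝓝[≠] 0) (𝓝 (Complex.I * ((Real.pi * m / ℓ : ℝ) : ℂ) * fourierCoeff g m)) := by
      have h1 : HasDerivAt (fun t : ℝ =>
          Complex.exp (Complex.I * (Real.pi * m / ℓ : ℝ) * t) * fourierCoeff g m)
          (Complex.I * ((Real.pi * m / ℓ : ℝ) : ℂ) * fourierCoeff g m) 0 := by
        refine HasDerivAt.mul_const ?_ _
        have h1 := ((hasDerivAt_id (0 : ℝ)).ofReal_comp.const_mul
          (Complex.I * (Real.pi * m / ℓ : ℝ))).cexp
        simpa using h1
      refine h1.tendsto_slope.congr fun t => ?_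
      have hint : ∀ τ : ℝ, Integrable (fun z => fourier (-m) z • F z τ) haarAddCircle := fun τ =>
        Continuous.integrable_of_hasCompactSupport (by simp only [F]; fun_prop)
          (HasCompactSupport.of_compactSpace _)
      have hval : ∀ τ : ℝ, Complex.exp (Complex.I * (Real.pi * m / ℓ : ℝ) * τ) * fourierCoeff g m
          = ∫ z, fourier (-m) z • F z τ ∂haarAddCircle := fun τ =>
        (fourierCoeff_translate g τ m).symm
      simp only [slope_def_module, hval]
      rw [← integral_sub (hint t) (hint 0), ← integral_smul]
      refine integral_congr_ae (Filter.Eventually.of_forall fun z => ?_)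
      simp only [smul_sub]
      rw [smul_comm _ (fourier (-m) z), smul_comm _ (fourier (-m) z)]
    exact tendsto_nhds_unique hlim1 hlim2
  have hGL : MemLp (fun z => -Complex.I * G z) 2 haarAddCircle := by
    refine MemLp.of_bound (by fun_prop) K (Filter.Eventually.of_forall fun z => ?_)
    rw [norm_mul, norm_neg, Complex.norm_I, one_mul]
    exact hGb z
  obtain ⟨hg, hgD⟩ := exists_diagonalOperator_eq (b := fourierBasis (T := 2 * ℓ))
    (c := fun k => Real.pi * k / ℓ) (x := ContinuousMap.toLp 2 haarAddCircle ℂ g) (y := hGL.toLp)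
    (fun k => by
      rw [fourierBasis_repr, fourierBasis_repr, fourierCoeff_toLp,
        fourierCoeff_congr_ae hGL.coeFn_toLp, fourierCoeff.const_mul, hcoeff]
      linear_combination (- ((Real.pi * k / ℓ : ℝ) : ℂ) * fourierCoeff g k) * Complex.I_mul_I)
  refine ⟨hg, ?_⟩
  rw [show circleD ℓ ⟨_, hg⟩ = hGL.toLp from hgD, eLpNorm_congr_ae hGL.coeFn_toLp]
  refine (eLpNorm_le_of_ae_bound (C := K) (Filter.Eventually.of_forall fun z => ?_)).trans ?_
  · rw [norm_mul, norm_neg, Complex.norm_I, one_mul]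
    exact hGb z
  · simp

end Circle

/-! ### Bounded commutators -/

/-- A bound of the commutator on its natural domain extends in the weak sense to the whole domain
of `D`. -/
theorem IsBoundedCommutator.exists_norm_inner_sub_le {H : Type*} [NormedAddCommGroup H]
    [InnerProductSpace ℂ H] {D : H →ₗ.[ℂ] H} {T : H →L[ℂ] H} (h : IsBoundedCommutator D T) :
    ∃ C : ℝ≥0, ∀ ψ ψ' : H, (∀ x : D.domain, inner ℂ ψ' (x : H) = inner ℂ ψ (D x)) →
      ∀ φ : D.domain, ‖inner ℂ ψ' (T φ) - inner ℂ ψ (T (D φ))‖ ≤ C * ‖ψ‖ * ‖(φ : H)‖ := by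
  obtain ⟨hcore, C, hC⟩ := h
  refine ⟨C.toNNReal, fun ψ ψ' hψ φ => ?_⟩
  -- For fixed `ψ` and `ψ'` the estimate is a closed condition on the pair `(φ, Dφ)`, so it passes
  -- from the graph over the core to the graph of `D`.
  let Z : Set (H × H) := {p | ‖inner ℂ ψ' (T p.1) - inner ℂ ψ (T p.2)‖ ≤ C.toNNReal * ‖ψ‖ * ‖p.1‖}
  have hZ : IsClosed Z := isClosed_le (by fun_prop) (by fun_prop)
  have hgr : ((D.domRestrict (commutator D T).domain).graph : Set (H × H)) ⊆ Z := by
    intro p hp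
    obtain ⟨x, hx1, hx2⟩ := (LinearPMap.mem_graph_iff _).1 hp
    have hx : (x : H) ∈ (commutator D T).domain := x.2.1
    have hD : D.domRestrict (commutator D T).domain x = D ⟨x, hx.1⟩ :=
      LinearPMap.domRestrict_apply rfl
    have h1 := hψ ⟨T x, hx.2⟩
    have h2 := hC ⟨x, hx⟩
    have h3 : commutator D T ⟨x, hx⟩ = D ⟨T x, hx.2⟩ - T (D ⟨x, hx.1⟩) := rfl
    simp only [Z, mem_ofPred_eq, ← hx1, ← hx2, hD]
    rw [show inner ℂ ψ' (T (x : H)) = inner ℂ ψ (D ⟨T x, hx.2⟩) from h1, ← inner_sub_right, ← h3]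
    refine (norm_inner_le_norm _ _).trans ?_
    calc ‖ψ‖ * ‖commutator D T ⟨x, hx⟩‖ ≤ ‖ψ‖ * (C.toNNReal * ‖(x : H)‖) := by
          gcongr
          exact h2.trans (by gcongr; exact Real.le_coe_toNNReal C)
      _ = _ := by ring
  have hmem : ((φ : H), D φ) ∈ closure
      ((D.domRestrict (commutator D T).domain).graph : Set (H × H)) := by
    have h1 : ((φ : H), D φ) ∈ D.graph := LinearPMap.mem_graph D φ
    rw [show D.graph = (D.domRestrict (commutator D T).domain).closure.graph by
      rw [hcore.closure_eq]] at h1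
    by_cases hcl : (D.domRestrict (commutator D T).domain).IsClosable
    · rwa [← hcl.graph_closure_eq_closure_graph] at h1
    -- By convention the closure of a non-closable operator is the operator itself.
    · rw [LinearPMap.closure_def' hcl] at h1
      exact subset_closure h1
  exact closure_minimal hgr hZ hmem

open Classical in
theorem exists_directSumOperator_single_eq {ι : Type*} {E : ι → Type*}
    [∀ i, NormedAddCommGroup (E i)] [∀ i, InnerProductSpace ℂ (E i)] (D : ∀ i, E i →ₗ.[ℂ] E i)
    (e : ι) (x : (D e).domain) :
    ∃ hx : lp.single 2 e (x : E e) ∈ (directSumOperator D).domain,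
      directSumOperator D ⟨_, hx⟩ = lp.single 2 e (D e x) := by
  have hd : ∀ i, lp.single 2 e (x : E e) i ∈ (D i).domain := by
    intro i
    rcases eq_or_ne i e with rfl | hi
    · rw [lp.single_apply_self]; exact x.2
    · rw [lp.single_apply_ne 2 e _ hi]; exact (D i).domain.zero_mem
  have hval : ∀ i, D i ⟨_, hd i⟩ = lp.single 2 e (D e x) i := by
    intro i
    rcases eq_or_ne i e with rfl | hi
    · exact (congrArg (D i) (Subtype.ext (lp.single_apply_self 2 i (x : E i)))).trans
        (lp.single_apply_self 2 i _).symm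
    · have h0 : (⟨_, hd i⟩ : (D i).domain) = 0 := Subtype.ext (lp.single_apply_ne 2 e _ hi)
      exact ((congrArg (D i) h0).trans (D i).map_zero).trans (lp.single_apply_ne 2 e _ hi).symm
  have hmem : Memℓp (fun i => D i ⟨_, hd i⟩) 2 := by
    rw [funext hval]
    exact lp.memℓp _
  exact ⟨⟨hd, hmem⟩, lp.ext (funext hval)⟩

open Classical in
-- Testing on vectors supported in one summand localizes the bound; the constant does not depend on
-- the summand.
theorem IsBoundedCommutator.exists_norm_inner_sub_le_component {ι : Type*} {E : ι → Type*}
    [∀ i, NormedAddCommGroup (E i)] [∀ i, InnerProductSpace ℂ (E i)] {D : ∀ i, E i →ₗ.[ℂ] E i}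
    {T : lp E 2 →L[ℂ] lp E 2} {S : ∀ i, E i →L[ℂ] E i} (hTS : ∀ y i, T y i = S i (y i))
    (h : IsBoundedCommutator (directSumOperator D) T) :
    ∃ C : ℝ≥0, ∀ (i : ι) (ψ ψ' : E i),
      (∀ x : (D i).domain, inner ℂ ψ' (x : E i) = inner ℂ ψ (D i x)) → ∀ φ : (D i).domain,
        ‖inner ℂ ψ' (S i φ) - inner ℂ ψ (S i (D i φ))‖ ≤ C * ‖ψ‖ * ‖(φ : E i)‖ := by
  obtain ⟨C, hC⟩ := h.exists_norm_inner_sub_le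
  refine ⟨C, fun e ψ ψ' hψ φ => ?_⟩
  obtain ⟨hx, hDx⟩ := exists_directSumOperator_single_eq D e φ
  have hψe : ∀ x : (directSumOperator D).domain,
      inner ℂ (lp.single 2 e ψ' : lp E 2) (x : lp E 2) =
        inner ℂ (lp.single 2 e ψ : lp E 2) (directSumOperator D x) := by
    intro x
    rw [lp.inner_single_left, lp.inner_single_left]
    exact hψ ⟨(x : lp E 2) e, x.2.1 e⟩
  have hmain := hC _ _ hψe ⟨_, hx⟩
  rw [hDx, lp.inner_single_left, lp.inner_single_left, hTS, hTS, lp.single_apply_self,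
    lp.single_apply_self, lp.norm_single (by norm_num), lp.norm_single (by norm_num)] at hmain
  exact hmain

/-- The eigenvalue of `D_ℓ` with index `k`. -/
abbrev diracEigenvalue (ℓ : ℝ) (k : ℤ) : ℝ := (2 * k + 1) * Real.pi / (2 * ℓ)

section Circle

variable {ℓ : ℝ} [hℓ : Fact (0 < 2 * ℓ)]

theorem exists_curveDirac_sum_eq (s : Finset ℤ) (a : ℤ → ℂ) :
    ∃ hx : ∑ m ∈ s, a m • mono ℓ m ∈ (curveDirac ℓ).domain,
      curveDirac ℓ ⟨_, hx⟩ = ∑ m ∈ s, (diracEigenvalue ℓ m * a m) • mono ℓ m := by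
  have h := exists_diagonalOperator_sum_eq (fourierBasis (T := 2 * ℓ)) (diracEigenvalue ℓ) s a
  rw [coe_fourierBasis] at h
  exact h

theorem inner_curveDirac_sum (s : Finset ℤ) (a : ℤ → ℂ) (x : (curveDirac ℓ).domain) :
    inner ℂ (∑ m ∈ s, (diracEigenvalue ℓ m * a m) • mono ℓ m) (x : CircleL2 ℓ) =
      inner ℂ (∑ m ∈ s, a m • mono ℓ m) (curveDirac ℓ x) := by
  have h := inner_diagonalOperator_sum (fourierBasis (T := 2 * ℓ)) (diracEigenvalue ℓ) s a x
  rw [coe_fourierBasis] at h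
  exact h

theorem norm_translate_sub_le_of_curveDirac {g : C(AddCircle (2 * ℓ), ℂ)} {C : ℝ}
    (h : ∀ ψ ψ' : CircleL2 ℓ,
      (∀ x : (curveDirac ℓ).domain, inner ℂ ψ' (x : CircleL2 ℓ) = inner ℂ ψ (curveDirac ℓ x)) →
      ∀ φ : (curveDirac ℓ).domain,
        ‖inner ℂ ψ' (mulOperator ℓ g φ) - inner ℂ ψ (mulOperator ℓ g (curveDirac ℓ φ))‖ ≤
          C * ‖ψ‖ * ‖(φ : CircleL2 ℓ)‖) (z : AddCircle (2 * ℓ)) (t : ℝ) :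
    ‖g (z + (t : AddCircle (2 * ℓ))) - g z‖ ≤ C * |t| := by
  refine norm_translate_sub_le (fun s a b => ?_) z t
  have hℓ0 : ℓ ≠ 0 := by have := hℓ.out; intro h; simp [h] at this
  obtain ⟨hφ, hDφ⟩ := exists_curveDirac_sum_eq (ℓ := ℓ) s b
  have hmain := h _ _ (inner_curveDirac_sum s a) ⟨_, hφ⟩
  rw [hDφ, norm_sum_mono, norm_sum_mono, inner_sum_mono_mulOperator,
    inner_sum_mono_mulOperator] at hmain
  refine le_trans (le_of_eq (congrArg norm ?_)) hmain
  simp only [← Finset.sum_sub_distrib]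
  refine Finset.sum_congr rfl fun m _ => Finset.sum_congr rfl fun n _ => ?_
  -- The shift `π/(2ℓ)` cancels in the difference of eigenvalues.
  have hc : (((Real.pi * (m - n : ℤ) / ℓ : ℝ)) : ℂ) =
      (diracEigenvalue ℓ m : ℂ) - diracEigenvalue ℓ n := by
    rw [← Complex.ofReal_sub]
    congr 1
    simp only [diracEigenvalue]
    push_cast
    field_simp
    ring
  rw [hc, map_mul, Complex.conj_ofReal]
  ring

end Circle

/-- Under a bounded commutator, the functions on the edges are uniformly Lipschitz. -/
theorem exists_norm_edgePullback_translate_sub_le {α : Param} {f : C(gasket α, ℂ)}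
    (hf : IsBoundedCommutator (gasketDirac α) (gasketRep α f)) :
    ∃ C : ℝ≥0, ∀ e, ∀ (z : AddCircle (2 * edgeLength α e)) (t : ℝ),
      ‖edgePullback α f e (z + (t : AddCircle (2 * edgeLength α e))) - edgePullback α f e z‖ ≤
        C * |t| := by
  obtain ⟨C, hC⟩ := hf.exists_norm_inner_sub_le_component
    (S := fun e => mulOperator (edgeLength α e) (edgePullback α f e)) fun _ _ => rfl
  exact ⟨C, fun e => norm_translate_sub_le_of_curveDirac (hC e)⟩

/-! ### Functions on an edge and on its double -/

theorem edgePullback_coe (α : Param) (f : C(gasket α, ℂ)) (e : Edge)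
    (t : Icc 0 (edgeLength α e)) :
    edgePullback α f e ((t : ℝ) : AddCircle (2 * edgeLength α e)) = f (edgeCurve α e t) := by
  have h : fold (edgeLength α e) ((t : ℝ) : AddCircle (2 * edgeLength α e)) = t := by
    refine Subtype.ext ?_
    rw [fold_coe _ ⟨by linarith [t.2.1, t.2.2], t.2.2⟩, abs_of_nonneg t.2.1]
  rw [edgePullback, ContinuousMap.comp_apply, ContinuousMap.comp_apply, h]

/-- Folding is the norm of the circle, hence 1-Lipschitz. Conversely, restricting the double to `[0,
ℓ]` recovers the edge. -/
theorem lipschitzWith_edge_iff {α : Param} {f : C(gasket α, ℂ)} {e : Edge} {M : ℝ≥0} :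
    (LipschitzWith M fun t => f (edgeCurve α e t)) ↔
      ∀ (z : AddCircle (2 * edgeLength α e)) (t : ℝ),
        ‖edgePullback α f e (z + (t : AddCircle (2 * edgeLength α e))) - edgePullback α f e z‖ ≤
          M * |t| := by
  constructor
  · intro h z t
    have h1 := h.dist_le_mul (fold _ (z + (t : AddCircle (2 * edgeLength α e)))) (fold _ z)
    rw [dist_eq_norm] at h1
    refine h1.trans ?_
    gcongr
    refine (abs_norm_sub_norm_le (z + (t : AddCircle (2 * edgeLength α e))) z).trans ?_
    rw [add_sub_cancel_left]
    exact QuotientAddGroup.norm_mk_le_norm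
  · intro h
    refine LipschitzWith.of_dist_le_mul fun s t => ?_
    have h1 := h ((t : ℝ) : AddCircle (2 * edgeLength α e)) (s - t)
    rw [← AddCircle.coe_add, add_sub_cancel, edgePullback_coe, edgePullback_coe] at h1
    rw [dist_eq_norm]
    exact h1

end StretchedGasket

end

theorem mainTheorem10 (α : StretchedGasket.Param) (f : C(StretchedGasket.gasket α, ℂ))
    (hf : StretchedGasket.IsBoundedCommutator (StretchedGasket.gasketDirac α)
      (StretchedGasket.gasketRep α f)) :
    ∃ hdom : ∀ e, StretchedGasket.edgeFunction α f e ∈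
        (StretchedGasket.circleD (StretchedGasket.edgeLength α e)).domain,
      StretchedGasket.derivSupNorm α f hdom = StretchedGasket.geodesicLip f ∧
      StretchedGasket.geodesicLip f < ⊤ := by
  obtain ⟨C, hC⟩ := StretchedGasket.exists_norm_edgePullback_translate_sub_le hf
  have key : ∀ {K : ℝ≥0}, (∀ e, LipschitzWith K fun t => f (StretchedGasket.edgeCurve α e t)) →
      ∀ e, ∃ hdom : StretchedGasket.edgeFunction α f e ∈
        (StretchedGasket.circleD (StretchedGasket.edgeLength α e)).domain,
        eLpNorm (StretchedGasket.circleD (StretchedGasket.edgeLength α e) ⟨_, hdom⟩) ∞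
          AddCircle.haarAddCircle ≤ K := fun h e =>
    StretchedGasket.exists_circleD_of_lipschitz (StretchedGasket.lipschitzWith_edge_iff.1 (h e))
  have hlipC : ∀ e, LipschitzWith C fun t => f (StretchedGasket.edgeCurve α e t) := fun e =>
    StretchedGasket.lipschitzWith_edge_iff.2 (hC e)
  have hLip : StretchedGasket.geodesicLip f ≤ C := StretchedGasket.geodesicLip_le hlipC
  have hLip' : StretchedGasket.geodesicLip f < ⊤ := hLip.trans_lt ENNReal.coe_lt_top
  have hdom := fun e => (key hlipC e).1
  have hle : ∀ {K : ℝ≥0}, (∀ e, LipschitzWith K fun t => f (StretchedGasket.edgeCurve α e t)) →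
      StretchedGasket.derivSupNorm α f hdom ≤ K := fun h => iSup_le fun e => (key h e).2
  refine ⟨hdom, le_antisymm ?_ ?_, hLip'⟩
  -- The uniform constant `C` has served for domain and finiteness; the sharp bound uses `K` equal
  -- to the seminorm itself.
  · rw [← ENNReal.coe_toNNReal hLip'.ne]
    exact hle (StretchedGasket.lipschitzWith_edge (ENNReal.coe_toNNReal hLip'.ne).ge)
  · have hfin : StretchedGasket.derivSupNorm α f hdom ≠ ⊤ :=
      ((hle hlipC).trans_lt ENNReal.coe_lt_top).ne
    -- Now `K` is the supremum of the derivative norms, which bounds the derivative on each edge.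
    rw [← ENNReal.coe_toNNReal hfin]
    refine StretchedGasket.geodesicLip_le fun e => StretchedGasket.lipschitzWith_edge_iff.2 ?_
    refine StretchedGasket.norm_translate_sub_le_of_circleD (hdom e) ?_
    rw [ENNReal.coe_toNNReal hfin]
    exact le_iSup (fun e => eLpNorm (StretchedGasket.circleD (StretchedGasket.edgeLength α e)
      ⟨StretchedGasket.edgeFunction α f e, hdom e⟩) ∞ AddCircle.haarAddCircle) e
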